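/- Let $d,m$ be dimensions and let $n>d-1$ be a real number. Let $M\in\mathbb R^{d\times m}$, and let $K\in\mathbb R^{m\times m}$ and $Q\in\mathbb R^{d\times d}$ be symmetric positive definite. Write $|\cdot|$ for the determinant. For $A,M\in\mathbb R^{d\times m}$ and symmetric positive definite $V\in\mathbb R^{d\times d}$ let $$\mathcal N_A(M,V,K)=\frac{|K|^{d/2}}{|2\pi V|^{m/2}}\exp\!\Big(-\tfrac12\operatorname{tr}\big((A-M)^TV^{-1}(A-M)K\big)\Big),$$ $$\mathcal{IW}_V(Q,n)=\frac1{Z_{n,d}}\,\frac1{|V|^{(d+1)/2}}\Big|\frac{V^{-1}Q}{2}\Big|^{n/2}\exp\!\Big(-\tfrac12\operatorname{tr}(V^{-1}Q)\Big),\qquad Z_{n,d}=\pi^{d(d-1)/4}\prod_{i=1}^d\Gamma\!\Big(\frac{n+1-i}2\Big)$$ be the matrix normal density and the inverted Wishart density (the latter being $0$ when $V$ is not positive definite). Suppose that $(A,V)$ has the prior density $\mathcal N_A(M,V,K)\,\mathcal{IW}_V(Q,n)$ with respect to Lebesgue measure in the $dm$ entries of $A$ and the $d(d+1)/2$ entries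 on and above the diagonal of the symmetric matrix $V$, and that, given $A$, $V$ and an input $x\in\mathbb R^m$, the observation $y\in\mathbb R^d$ is normal with mean $Ax$ and covariance matrix $V$, with density $\mathcal N_y(Ax,V)$. Let $$P(A,V|x,y)=\frac{\mathcal N_y(Ax,V)\,\mathcal N_A(M,V,K)\,\mathcal{IW}_V(Q,n)}{\int\!\!\int \mathcal N_y(A'x,V')\,\mathcal N_{A'}(M,V',K)\,\mathcal{IW}_{V'}(Q,n)\,dA'\,dV'}$$ be the posterior density, and put $\gamma=1-x^T(xx^T+K)^{-1}x$. The entropy of a probability density $p$ is $-\int p\ln p$. Then for each fixed $m$ there is a function $f_1(d,n)$ of $d$ and $n$ only such that, for all $d$, $n>d-1$, $M$, $K$, $Q$ as above: (i) the prior is a probability density whose entropy exists (the integral converges absolutely) and equals $-\frac d2\ln|K|+\frac{m+d+1}2\ln|Q|+f_1(d,n)$; (ii) for all $x\in\mathbb R^m$, $y\in\mathbb R^d$, the posterior $P(A,V|x,y)$ is a probability density whose entropy exists (the integral converges absolutely) and equals $$-\frac d2\ln|xx^T+K|+f_1(d,n+1)+\frac{m+d+1}2\ln\big|Q+(y-Mx)\gamma(y-Mx)^T\big|.$$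 -/

import Mathlib

open MeasureTheory
open scoped Matrix

noncomputable section

namespace BayesRNN

/-- Density at `y` of the normal distribution on `ℝ^d` with mean `μ` and covariance matrix `V`
(for positive definite `V`). -/
def gaussianDensity {d : ℕ} (μ : Fin d → ℝ) (V : Matrix (Fin d) (Fin d) ℝ) (y : Fin d → ℝ) : ℝ :=
  ((2 * Real.pi) • V).det ^ (-(1 / 2 : ℝ)) * Real.exp (-(1 / 2) * ((y - μ) ⬝ᵥ (V⁻¹ *ᵥ (y - μ))))

/-- Density at `A` of the matrix normal distribution with mean `M`, row covariance `V` and column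
precision matrix `K` (for positive definite `V` and `K`). -/
def matrixNormalDensity {d m : ℕ} (M : Matrix (Fin d) (Fin m) ℝ) (V : Matrix (Fin d) (Fin d) ℝ)
    (K : Matrix (Fin m) (Fin m) ℝ) (A : Matrix (Fin d) (Fin m) ℝ) : ℝ :=
  K.det ^ ((d : ℝ) / 2) / ((2 * Real.pi) • V).det ^ ((m : ℝ) / 2) *
    Real.exp (-(1 / 2) * ((A - M)ᵀ * V⁻¹ * (A - M) * K).trace)

/-- The constant `Z_{n,d} = π^{d(d-1)/4} ∏_{i=1}^d Γ((n+1-i)/2)`; below `i` runs over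
`0, …, d-1`. -/
def iwConst (n : ℝ) (d : ℕ) : ℝ :=
  Real.pi ^ ((d : ℝ) * ((d : ℝ) - 1) / 4) * ∏ i : Fin d, Real.Gamma ((n - (i : ℝ)) / 2)

open Classical in
/-- Density at `V` of the inverted Wishart distribution with scale matrix `Q` and `n` degrees of
freedom. The distribution lives on the positive definite matrices. -/
def invWishartDensity {d : ℕ} (Q : Matrix (Fin d) (Fin d) ℝ) (n : ℝ)
    (V : Matrix (Fin d) (Fin d) ℝ) : ℝ :=
  if V.PosDef then
    1 / iwConst n d * (1 / V.det ^ (((d : ℝ) + 1) / 2)) *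
      ((1 / 2 : ℝ) • (V⁻¹ * Q)).det ^ (n / 2) * Real.exp (-(1 / 2) * (V⁻¹ * Q).trace)
  else 0

/-- The index set of the `d(d+1)/2` free entries of a symmetric `d × d` matrix. -/
abbrev UpperIdx (d : ℕ) : Type := {p : Fin d × Fin d // p.1 ≤ p.2}

/-- The symmetric matrix with given entries on and above the diagonal. -/
def symMatrix {d : ℕ} (v : UpperIdx d → ℝ) : Matrix (Fin d) (Fin d) ℝ :=
  Matrix.of fun i j => v ⟨(min i j, max i j), min_le_max⟩

/-- Coordinates of a pair `(A, V)` of a `d × m` matrix and a symmetric `d × d` matrix. Densities of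
`(A, V)` are taken with respect to Lebesgue measure `volume` in these coordinates. -/
abbrev Param (d m : ℕ) : Type := (Fin d → Fin m → ℝ) × (UpperIdx d → ℝ)

/-- The matrix `A` of a parameter. -/
def Param.A {d m : ℕ} (θ : Param d m) : Matrix (Fin d) (Fin m) ℝ := Matrix.of θ.1

/-- The symmetric matrix `V` of a parameter. -/
def Param.V {d m : ℕ} (θ : Param d m) : Matrix (Fin d) (Fin d) ℝ := symMatrix θ.2

/-- The prior density of `(A, V)`: `V` is inverted Wishart, and `A` given `V` is matrix normal. -/
def priorDensity {d m : ℕ} (M : Matrix (Fin d) (Fin m) ℝ) (K : Matrix (Fin m) (Fin m) ℝ)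
    (Q : Matrix (Fin d) (Fin d) ℝ) (n : ℝ) (θ : Param d m) : ℝ :=
  matrixNormalDensity M (Param.V θ) K (Param.A θ) * invWishartDensity Q n (Param.V θ)

/-- The density of `y` given the input `x` and the parameters, in the model `y = A x + e`,
`e ∼ N(0, V)`. -/
def likelihood {d m : ℕ} (x : Fin m → ℝ) (y : Fin d → ℝ) (θ : Param d m) : ℝ :=
  gaussianDensity (Param.A θ *ᵥ x) (Param.V θ) y

/-- The posterior density of `(A, V)` after observing `(x, y)`, by Bayes' rule. -/
def posteriorDensity {d m : ℕ} (M : Matrix (Fin d) (Fin m) ℝ) (K : Matrix (Fin m) (Fin m) ℝ)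
    (Q : Matrix (Fin d) (Fin d) ℝ) (n : ℝ) (x : Fin m → ℝ) (y : Fin d → ℝ) (θ : Param d m) : ℝ :=
  likelihood x y θ * priorDensity M K Q n θ /
    ∫ θ' : Param d m, likelihood x y θ' * priorDensity M K Q n θ'

/-- `p` is a probability density with respect to `ν`. -/
structure IsProbDensity {Ω : Type*} [MeasurableSpace Ω] (ν : Measure Ω) (p : Ω → ℝ) : Prop where
  nonneg : ∀ ω, 0 ≤ p ω
  integrable : Integrable p ν
  integral_eq_one : ∫ ω, p ω ∂ν = 1

/-- `p` is a probability density with respect to `ν`, and its differential entropy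
`-∫ p ln p dν` exists (the integral converges absolutely) and equals `h`. -/
structure HasEntropy {Ω : Type*} [MeasurableSpace Ω] (ν : Measure Ω) (p : Ω → ℝ) (h : ℝ) :
    Prop where
  isProbDensity : IsProbDensity ν p
  integrable : Integrable (fun ω => p ω * Real.log (p ω)) ν
  entropy_eq : -∫ ω, p ω * Real.log (p ω) ∂ν = h

/-- The scalar `γ = 1 - xᵀ (x xᵀ + K)⁻¹ x`. -/
def gammaScalar {m : ℕ} (K : Matrix (Fin m) (Fin m) ℝ) (x : Fin m → ℝ) : ℝ :=
  1 - x ⬝ᵥ ((Matrix.vecMulVec x x + K)⁻¹ *ᵥ x)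

end BayesRNN

end

noncomputable section

namespace BayesRNN

/-! On positive definite `V` the prior density is a constant times |V|^(-(n+d+1+m)/2) exp(-½ tr
V⁻¹S), where S = Q + (A-M)K(A-M)ᵀ (`priorDensity_of_posDef`). Everything follows from this
exponential form.

Mass one: for fixed `V` the integral over `A` is Gaussian with precision V⁻¹ ⊗ K. What remains is
the inverse Wishart integral, computed by induction on `d` (`lintegral_iwKernel`). In terms of the
leading block, the last column and the Schur complement of the corner, the kernel is a smaller
kernel times a Gaussian in the column times an inverse Gamma density in the Schur complement.

Entropy: the power p^s of a prior density is a multiple of the prior density with parameters sK, sQ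
and shifted `n`. As all these have mass one, ∫ p^s = J^(1-s) ∫ p₁^s, where J = |K|^(-d/2)
|Q|^((m+d+1)/2) and p₁ is the prior with M = 0, K = 1, Q = 1. Differentiating at s = 1 shows that
the entropy of p is log J plus that of p₁, which is the constant f₁; no explicit formula for f₁ is
needed.

Posterior: completing the square (`scatter_add_vecMulVec`) makes the posterior a prior density with
`n + 1` degrees of freedom, so the second claim is an instance of the first. -/

/-! ### Gaussian integrals over vectors and matrices -/

lemma measurePreserving_uncurry (ι κ : Type*) [Fintype ι] [Fintype κ] :
    MeasurePreserving (MeasurableEquiv.curry ι κ ℝ).symm volume volume := by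
  refine ⟨(MeasurableEquiv.curry ι κ ℝ).symm.measurable, ?_⟩
  refine (Measure.pi_eq fun s hs => ?_).symm
  rw [MeasurableEquiv.map_apply]
  have : (MeasurableEquiv.curry ι κ ℝ).symm ⁻¹' (Set.univ.pi s)
      = Set.univ.pi fun i => Set.univ.pi fun j => s (i, j) := by
    ext f
    simp [Set.mem_pi, MeasurableEquiv.curry]
  rw [this, volume_pi_pi]
  simp_rw [volume_pi_pi]
  rw [Fintype.prod_prod_type]

/-- The standard Gaussian integral on `ι → ℝ`. -/
lemma lintegral_exp_neg_half_dotProduct_self (ι : Type*) [Fintype ι] :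
    ∫⁻ x : ι → ℝ, ENNReal.ofReal (Real.exp (-(1 / 2) * (x ⬝ᵥ x)))
      = ENNReal.ofReal ((2 * Real.pi) ^ ((Fintype.card ι : ℝ) / 2)) := by
  have hprod : ∀ x : ι → ℝ, Real.exp (-(1 / 2) * (x ⬝ᵥ x))
      = ∏ i, Real.exp (-(1 / 2) * (x i) ^ 2) := by
    intro x
    rw [← Real.exp_sum, dotProduct, Finset.mul_sum]
    congr 1
    exact Finset.sum_congr rfl fun i _ => by ring
  have hint : Integrable (fun x : ι → ℝ => ∏ i, Real.exp (-(1 / 2) * (x i) ^ 2)) :=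
    Integrable.fintype_prod (fun _ => integrable_exp_neg_mul_sq (by norm_num))
  simp_rw [hprod]
  rw [← ofReal_integral_eq_lintegral_ofReal hint
    (Filter.Eventually.of_forall fun x => Finset.prod_nonneg fun i _ => (Real.exp_pos _).le)]
  rw [integral_fintype_prod_volume_eq_pow (fun t : ℝ => Real.exp (-(1 / 2) * t ^ 2)),
    integral_gaussian]
  congr 1
  rw [Real.sqrt_eq_rpow, ← Real.rpow_natCast, ← Real.rpow_mul (by positivity)]
  congr 1 <;> ring

lemma lintegral_comp_mulVec {ι : Type*} [Fintype ι] [DecidableEq ι] (B : Matrix ι ι ℝ)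
    (hB : B.det ≠ 0) (f : (ι → ℝ) → ENNReal) (hf : Measurable f) :
    ∫⁻ x, f (B *ᵥ x) = ENNReal.ofReal |B.det|⁻¹ * ∫⁻ x, f x := by
  have h := Real.map_matrix_volume_pi_eq_smul_volume_pi hB
  have hm : Measurable (Matrix.toLin' B) :=
    (LinearMap.continuous_of_finiteDimensional _).measurable
  have h2 := lintegral_map (μ := volume) hf hm
  rw [h, lintegral_smul_measure] at h2
  simp only [Matrix.toLin'_apply, smul_eq_mul] at h2
  rw [← h2, abs_inv]

-- Nonnegative elements of a C⋆-algebra have the form B⋆B; the opened scopes give matrices that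
-- structure.
open scoped MatrixOrder Matrix.Norms.L2Operator in
lemma exists_transpose_mul_self {ι : Type*} [Fintype ι] [DecidableEq ι] {S : Matrix ι ι ℝ}
    (hS : S.PosDef) : ∃ B : Matrix ι ι ℝ, S = Bᵀ * B := by
  obtain ⟨B, hB⟩ := CStarAlgebra.nonneg_iff_eq_star_mul_self.mp hS.posSemidef.nonneg
  exact ⟨B, by rw [hB, Matrix.star_eq_conjTranspose, Matrix.conjTranspose_eq_transpose_of_trivial]⟩

/-- The Gaussian integral of a positive definite quadratic form. -/
lemma lintegral_exp_neg_half_quadForm {ι : Type*} [Fintype ι] [DecidableEq ι] {S : Matrix ι ι ℝ}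
    (hS : S.PosDef) (μ : ι → ℝ) :
    ∫⁻ x : ι → ℝ, ENNReal.ofReal (Real.exp (-(1 / 2) * ((x - μ) ⬝ᵥ (S *ᵥ (x - μ)))))
      = ENNReal.ofReal ((2 * Real.pi) ^ ((Fintype.card ι : ℝ) / 2) / S.det ^ (1 / 2 : ℝ)) := by
  rw [lintegral_sub_right_eq_self
    (fun x => ENNReal.ofReal (Real.exp (-(1 / 2) * (x ⬝ᵥ (S *ᵥ x))))) μ]
  obtain ⟨B, rfl⟩ := exists_transpose_mul_self hS
  have hdet : (Bᵀ * B).det = |B.det| ^ 2 := by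
    rw [Matrix.det_mul, Matrix.det_transpose, sq_abs, sq]
  have hB : B.det ≠ 0 := by
    intro h
    have := hS.det_pos
    rw [hdet, h] at this
    simp at this
  have hq : ∀ x : ι → ℝ, x ⬝ᵥ ((Bᵀ * B) *ᵥ x) = (B *ᵥ x) ⬝ᵥ (B *ᵥ x) := by
    intro x
    rw [← Matrix.mulVec_mulVec, Matrix.dotProduct_mulVec, Matrix.vecMul_transpose]
  simp_rw [hq]
  rw [lintegral_comp_mulVec B hB
    (fun x => ENNReal.ofReal (Real.exp (-(1 / 2) * (x ⬝ᵥ x)))) (by fun_prop),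
    lintegral_exp_neg_half_dotProduct_self, ← ENNReal.ofReal_mul (by positivity), hdet,
    ← Real.sqrt_eq_rpow, Real.sqrt_sq (abs_nonneg _)]
  congr 1
  rw [div_eq_inv_mul (_ : ℝ) |B.det|]

/-- The matrix normal integral. -/
lemma lintegral_exp_neg_half_trace {ι κ : Type*} [Fintype ι] [Fintype κ] [DecidableEq ι]
    [DecidableEq κ] {S : Matrix ι ι ℝ} {K : Matrix κ κ ℝ} (hS : S.PosDef) (hK : K.PosDef)
    (M : Matrix ι κ ℝ) :
    ∫⁻ A : ι → κ → ℝ, ENNReal.ofReal (Real.exp (-(1 / 2) *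
        ((Matrix.of A - M)ᵀ * S * (Matrix.of A - M) * K).trace))
      = ENNReal.ofReal ((2 * Real.pi) ^ ((Fintype.card ι : ℝ) * Fintype.card κ / 2) /
        (S.det ^ ((Fintype.card κ : ℝ) / 2) * K.det ^ ((Fintype.card ι : ℝ) / 2))) := by
  have hSK : (Matrix.kronecker S K).PosDef := hS.kronecker hK
  -- Flattening the matrix to a vector turns the trace into the quadratic form of S ⊗ K; symmetry of
  -- `K` is used here.
  have hq : ∀ B : Matrix ι κ ℝ, (Bᵀ * S * B * K).trace
      = (fun p : ι × κ => B p.1 p.2) ⬝ᵥ ((Matrix.kronecker S K) *ᵥ fun p => B p.1 p.2) := by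
    intro B
    have hK' : ∀ i j, K i j = K j i := fun i j => by
      simpa using hK.isHermitian.apply j i
    have h1 : (Bᵀ * S * B * K).trace = ∑ i, ∑ j, B i j * (S * B * K) i j := by
      rw [Matrix.mul_assoc Bᵀ, Matrix.mul_assoc Bᵀ]
      simp only [Matrix.trace, Matrix.diag, Matrix.mul_apply (M := Bᵀ), Matrix.transpose_apply]
      exact Finset.sum_comm
    rw [h1, dotProduct, Fintype.sum_prod_type]
    refine Finset.sum_congr rfl fun i _ => Finset.sum_congr rfl fun j _ => ?_
    congr 1
    simp only [Matrix.mul_apply, Matrix.mulVec, dotProduct, Fintype.sum_prod_type,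
      Matrix.kronecker, Matrix.kroneckerMap_apply, Finset.sum_mul]
    rw [Finset.sum_comm]
    refine Finset.sum_congr rfl fun k _ => Finset.sum_congr rfl fun l _ => ?_
    rw [hK' l j]
    ring
  have key := lintegral_exp_neg_half_quadForm hSK (fun p => M p.1 p.2)
  rw [← (measurePreserving_uncurry ι κ).lintegral_comp (by fun_prop)] at key
  have hL : ∀ A : ι → κ → ℝ, ((Matrix.of A - M)ᵀ * S * (Matrix.of A - M) * K).trace
      = ((MeasurableEquiv.curry ι κ ℝ).symm A - fun p => M p.1 p.2) ⬝ᵥ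
        (Matrix.kronecker S K *ᵥ ((MeasurableEquiv.curry ι κ ℝ).symm A - fun p => M p.1 p.2)) := by
    intro A
    rw [hq]
    rfl
  simp_rw [hL]
  rw [key]
  congr 1
  have hS0 := hS.det_pos
  have hK0 := hK.det_pos
  rw [Matrix.kronecker, Matrix.det_kronecker, Real.mul_rpow (pow_nonneg hS0.le _)
    (pow_nonneg hK0.le _),
    ← Real.rpow_natCast, ← Real.rpow_natCast, ← Real.rpow_mul hS0.le, ← Real.rpow_mul hK0.le,
    Fintype.card_prod]
  push_cast
  congr 2 <;> congr 1 <;> ring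

/-! ### Bordered matrices and Schur complements -/

/-- The symmetric matrix obtained from `C` by adding a last row and column. -/
def bordered {d : ℕ} (C : Matrix (Fin d) (Fin d) ℝ) (b : Fin d → ℝ) (a : ℝ) :
    Matrix (Fin d ⊕ Fin 1) (Fin d ⊕ Fin 1) ℝ :=
  Matrix.fromBlocks C (Matrix.replicateCol (Fin 1) b) (Matrix.replicateRow (Fin 1) b)
    (Matrix.of fun _ _ => a)

/-- The Schur complement of `C` in `bordered C b a`. -/
def schur {d : ℕ} (C : Matrix (Fin d) (Fin d) ℝ) (b : Fin d → ℝ) (a : ℝ) : ℝ :=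
  a - b ⬝ᵥ (C⁻¹ *ᵥ b)

section bordered

variable {d : ℕ} {C : Matrix (Fin d) (Fin d) ℝ}

lemma schur_block (C : Matrix (Fin d) (Fin d) ℝ) (b : Fin d → ℝ) (a : ℝ) :
    (Matrix.of fun _ _ => a : Matrix (Fin 1) (Fin 1) ℝ)
        - Matrix.replicateRow (Fin 1) b * C⁻¹ * Matrix.replicateCol (Fin 1) b
      = Matrix.diagonal fun _ => schur C b a := by
  ext i j
  obtain rfl := Subsingleton.elim i j
  rw [Matrix.mul_assoc]
  simp [schur, Matrix.mul_apply, dotProduct, Matrix.mulVec]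

lemma det_bordered (hC : IsUnit C.det) (b : Fin d → ℝ) (a : ℝ) :
    (bordered C b a).det = C.det * schur C b a := by
  have := C.invertibleOfIsUnitDet hC
  rw [bordered, Matrix.det_fromBlocks₁₁, Matrix.invOf_eq_nonsing_inv, schur_block]
  simp

lemma isUnit_det_of_posDef {ι : Type*} [Fintype ι] [DecidableEq ι] {S : Matrix ι ι ℝ}
    (hS : S.PosDef) : IsUnit S.det :=
  isUnit_iff_ne_zero.2 hS.det_pos.ne'

/-- The block criterion gives only semidefiniteness; the determinant, |C| times the Schur
complement, upgrades it to definiteness. -/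
lemma posDef_bordered_iff (b : Fin d → ℝ) (a : ℝ) :
    (bordered C b a).PosDef ↔ C.PosDef ∧ 0 < schur C b a := by
  constructor
  · intro h
    have hC : C.PosDef := h.submatrix (e := Sum.inl) Sum.inl_injective
    refine ⟨hC, ?_⟩
    have := h.det_pos
    rw [det_bordered (isUnit_det_of_posDef hC)] at this
    exact pos_of_mul_pos_right this hC.det_pos.le
  · rintro ⟨hC, hs⟩
    have := C.invertibleOfIsUnitDet (isUnit_det_of_posDef hC)
    have hps : (bordered C b a).PosSemidef := by
      have h := (Matrix.PosDef.fromBlocks₁₁ (Matrix.replicateCol (Fin 1) b)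
        (Matrix.of fun _ _ => a) hC)
      rw [Matrix.conjTranspose_eq_transpose_of_trivial, Matrix.transpose_replicateCol,
        schur_block] at h
      exact h.2 (Matrix.PosSemidef.diagonal fun _ => hs.le)
    rw [hps.posDef_iff_det_ne_zero, det_bordered (isUnit_det_of_posDef hC)]
    exact (mul_pos hC.det_pos hs).ne'

lemma inv_bordered (hC : C.IsHermitian) (hC' : IsUnit C.det) (b : Fin d → ℝ) (a : ℝ)
    (hs : schur C b a ≠ 0) :
    (bordered C b a)⁻¹ = Matrix.fromBlocks
      (C⁻¹ + (schur C b a)⁻¹ • Matrix.vecMulVec (C⁻¹ *ᵥ b) (C⁻¹ *ᵥ b))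
      (-(schur C b a)⁻¹ • Matrix.replicateCol (Fin 1) (C⁻¹ *ᵥ b))
      (-(schur C b a)⁻¹ • Matrix.replicateRow (Fin 1) (C⁻¹ *ᵥ b))
      (Matrix.of fun _ _ => (schur C b a)⁻¹) := by
  have hCi : C⁻¹ᵀ = C⁻¹ := by
    rw [Matrix.transpose_nonsing_inv, ← Matrix.conjTranspose_eq_transpose_of_trivial, hC.eq]
  set u := C⁻¹ *ᵥ b with hu
  have hCu : C *ᵥ u = b := by
    rw [hu, Matrix.mulVec_mulVec, Matrix.mul_nonsing_inv _ hC', Matrix.one_mulVec]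
  have hbC : b ᵥ* C⁻¹ = u := by
    rw [hu, ← Matrix.mulVec_transpose, hCi]
  have hsb : schur C b a = a - b ⬝ᵥ u := rfl
  set s := schur C b a
  refine Matrix.inv_eq_right_inv ?_
  rw [bordered, Matrix.fromBlocks_multiply, ← Matrix.fromBlocks_one]
  congr 1
  · rw [Matrix.mul_add, Matrix.mul_nonsing_inv _ hC', Matrix.mul_smul, Matrix.mul_vecMulVec, hCu,
      add_assoc, add_eq_left]
    ext i j
    simp [Matrix.mul_apply, Matrix.vecMulVec_apply]
  · ext i j
    have := congrFun hCu i
    simp only [Matrix.mulVec, dotProduct] at this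
    simp [Matrix.mul_apply, ← this, Finset.mul_sum]
    rw [Finset.sum_mul, ← Finset.sum_neg_distrib, ← Finset.sum_add_distrib]
    exact Finset.sum_eq_zero fun k _ => by ring
  · ext i j
    have h1 := congrFun hbC j
    simp only [Matrix.vecMul, dotProduct] at h1
    simp only [Matrix.mul_add, Matrix.add_apply, Matrix.zero_apply]
    rw [Matrix.mul_smul, Matrix.mul_vecMulVec]
    simp [Matrix.mul_apply, h1, Matrix.vecMulVec_apply, Matrix.mulVec]
    have : b ⬝ᵥ u = a - s := by rw [hsb]; ring
    rw [this]
    field_simp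
    ring
  · ext i j
    obtain rfl := Subsingleton.elim i j
    have : b ⬝ᵥ u = a - s := by rw [hsb]; ring
    simp only [dotProduct] at this
    simp [Matrix.mul_apply]
    rw [this]
    field_simp
    ring

lemma trace_fromBlocks_eq {m n : Type*} [Fintype m] [Fintype n] (A : Matrix m m ℝ)
    (B : Matrix m n ℝ) (C : Matrix n m ℝ) (D : Matrix n n ℝ) :
    (Matrix.fromBlocks A B C D).trace = A.trace + D.trace := by
  simp [Matrix.trace, Fintype.sum_sum_type]

lemma quadForm_sub {S : Matrix (Fin d) (Fin d) ℝ} (hS : S.IsHermitian) (x y : Fin d → ℝ) :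
    (x - y) ⬝ᵥ (S *ᵥ (x - y)) = x ⬝ᵥ (S *ᵥ x) - 2 * (x ⬝ᵥ (S *ᵥ y)) + y ⬝ᵥ (S *ᵥ y) := by
  have hST : Sᵀ = S := by
    rw [← Matrix.conjTranspose_eq_transpose_of_trivial, hS.eq]
  have : y ⬝ᵥ (S *ᵥ x) = x ⬝ᵥ (S *ᵥ y) := by
    rw [Matrix.dotProduct_mulVec, ← Matrix.mulVec_transpose, hST, dotProduct_comm]
  rw [Matrix.mulVec_sub, sub_dotProduct, dotProduct_sub, dotProduct_sub, this]
  ring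

/-- Completing the square in `b` around C Q⁻¹ q separates the exponent: the trace for the smaller
block, a Gaussian form in `b` whose precision scales with the inverse Schur complement, and an
inverse Gamma term. -/
lemma trace_inv_bordered_mul (hC : C.IsHermitian) (hC' : IsUnit C.det) (b : Fin d → ℝ) (a : ℝ)
    (hs : schur C b a ≠ 0) (Q : Matrix (Fin d) (Fin d) ℝ) (q : Fin d → ℝ) (q₀ : ℝ)
    (hQ : Q.PosDef) :
    ((bordered C b a)⁻¹ * bordered Q q q₀).trace = (C⁻¹ * Q).trace +
      ((b - C *ᵥ (Q⁻¹ *ᵥ q)) ⬝ᵥ (((schur C b a)⁻¹ • (C⁻¹ * Q * C⁻¹)) *ᵥ (b - C *ᵥ (Q⁻¹ *ᵥ q)))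
        + (schur C b a)⁻¹ * schur Q q q₀) := by
  have hCi : C⁻¹ᵀ = C⁻¹ := by
    rw [Matrix.transpose_nonsing_inv, ← Matrix.conjTranspose_eq_transpose_of_trivial, hC.eq]
  have hQQ : Q *ᵥ (Q⁻¹ *ᵥ q) = q := by
    rw [Matrix.mulVec_mulVec, Matrix.mul_nonsing_inv _ (isUnit_det_of_posDef hQ),
      Matrix.one_mulVec]
  have hQT : Qᵀ = Q := by
    rw [← Matrix.conjTranspose_eq_transpose_of_trivial, hQ.isHermitian.eq]
  rw [inv_bordered hC hC' b a hs, bordered, Matrix.fromBlocks_multiply, trace_fromBlocks_eq]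
  set s := schur C b a
  set u := C⁻¹ *ᵥ b with hu
  have h1 : ∀ w : Fin d → ℝ, w ⬝ᵥ ((s⁻¹ • (C⁻¹ * Q * C⁻¹)) *ᵥ w)
      = s⁻¹ * ((C⁻¹ *ᵥ w) ⬝ᵥ (Q *ᵥ (C⁻¹ *ᵥ w))) := by
    intro w
    rw [Matrix.smul_mulVec, dotProduct_smul, smul_eq_mul, Matrix.mulVec_mulVec,
      Matrix.mul_assoc, ← Matrix.mulVec_mulVec, Matrix.dotProduct_mulVec,
      ← Matrix.mulVec_transpose, hCi]
  have h2 : C⁻¹ *ᵥ (b - C *ᵥ (Q⁻¹ *ᵥ q)) = u - Q⁻¹ *ᵥ q := by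
    rw [Matrix.mulVec_sub, Matrix.mulVec_mulVec, Matrix.nonsing_inv_mul _ hC', Matrix.one_mulVec]
  rw [h1, h2, quadForm_sub hQ.isHermitian, hQQ, schur, Matrix.add_mul, Matrix.smul_mul,
    Matrix.smul_mul, Matrix.trace_add, Matrix.trace_add, Matrix.trace_smul, Matrix.trace_smul,
    Matrix.trace_add, Matrix.smul_mul, Matrix.trace_smul, Matrix.vecMulVec_mul,
    Matrix.trace_vecMulVec, ← Matrix.mulVec_transpose, hQT]
  have h3 : (Matrix.replicateCol (Fin 1) u * Matrix.replicateRow (Fin 1) q).trace = u ⬝ᵥ q := by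
    simp [Matrix.trace, Matrix.mul_apply, dotProduct]
  have h4 : (Matrix.replicateRow (Fin 1) u * Matrix.replicateCol (Fin 1) q).trace = u ⬝ᵥ q := by
    simp [Matrix.trace, Matrix.mul_apply, dotProduct]
  have h5 : ((Matrix.of fun _ _ => s⁻¹ : Matrix (Fin 1) (Fin 1) ℝ) *
      Matrix.of fun _ _ => q₀).trace = s⁻¹ * q₀ := by
    simp [Matrix.trace, Matrix.mul_apply]
  rw [h3, h4, h5, dotProduct_comm (Q⁻¹ *ᵥ q) q]
  simp only [smul_eq_mul]
  ring

end bordered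

/-! ### The inverse Wishart kernel and measurability -/

open Classical in
/-- The unnormalised inverse Wishart density, as a function with values in `ℝ≥0∞`. -/
def iwKernel {ι : Type*} [Fintype ι] [DecidableEq ι] (Q : Matrix ι ι ℝ) (r : ℝ)
    (V : Matrix ι ι ℝ) : ENNReal :=
  if V.PosDef then ENNReal.ofReal (V.det ^ (-r) * Real.exp (-(1 / 2) * (V⁻¹ * Q).trace)) else 0

lemma posDef_submatrix_equiv_iff {ι κ : Type*} [Fintype ι] [Fintype κ] (e : κ ≃ ι)
    (V : Matrix ι ι ℝ) : (V.submatrix e e).PosDef ↔ V.PosDef := by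
  refine ⟨fun h => ?_, fun h => h.submatrix e.injective⟩
  simpa using h.submatrix (e := e.symm) e.symm.injective

lemma iwKernel_submatrix {ι κ : Type*} [Fintype ι] [DecidableEq ι] [Fintype κ] [DecidableEq κ]
    (e : κ ≃ ι) (Q : Matrix ι ι ℝ) (r : ℝ) (V : Matrix ι ι ℝ) :
    iwKernel (Q.submatrix e e) r (V.submatrix e e) = iwKernel Q r V := by
  unfold iwKernel
  rw [posDef_submatrix_equiv_iff, Matrix.det_submatrix_equiv_self, Matrix.inv_submatrix_equiv,
    Matrix.submatrix_mul_equiv]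
  have : ((V⁻¹ * Q).submatrix e e).trace = (V⁻¹ * Q).trace := by
    simp only [Matrix.trace, Matrix.diag, Matrix.submatrix_apply]
    exact Equiv.sum_comp e fun i => (V⁻¹ * Q) i i
  rw [this]

lemma symMatrix_isHermitian {d : ℕ} (v : UpperIdx d → ℝ) : (symMatrix v).IsHermitian := by
  ext i j
  simp [symMatrix, min_comm, max_comm]

section measurability

variable {α ι κ : Type*} [Fintype ι] [DecidableEq ι] [Fintype κ] [MeasurableSpace α]
  {V : α → Matrix ι ι ℝ}

lemma measurable_matrix_det (hV : ∀ i j, Measurable fun a => V a i j) :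
    Measurable fun a => (V a).det := by
  simp only [Matrix.det_apply]
  fun_prop

lemma measurable_matrix_inv (hV : ∀ i j, Measurable fun a => V a i j) (i j : ι) :
    Measurable fun a => (V a)⁻¹ i j := by
  simp only [Matrix.inv_def, Matrix.smul_apply, Ring.inverse_eq_inv', smul_eq_mul,
    Matrix.adjugate_apply]
  refine (measurable_matrix_det hV).inv.mul (measurable_matrix_det fun k l => ?_)
  simp only [Matrix.updateRow_apply]
  split_ifs
  · exact measurable_const
  · exact hV k l

/-- Among Hermitian matrices, positive definite means lying in the closed semidefinite cone with
nonzero determinant. -/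
lemma measurableSet_posDef (hV : ∀ i j, Measurable fun a => V a i j)
    (hs : ∀ a, (V a).IsHermitian) : MeasurableSet {a | (V a).PosDef} := by
  have hcont : IsClosed {W : ι → ι → ℝ | ∀ x : ι → ℝ, 0 ≤ x ⬝ᵥ (Matrix.of W *ᵥ x)} := by
    simp only [Set.ofPred_forall]
    refine isClosed_iInter fun x => isClosed_le continuous_const ?_
    simp only [dotProduct, Matrix.mulVec, Matrix.of_apply]
    fun_prop
  have hset : {a | (V a).PosDef}
      = (fun a i j => V a i j) ⁻¹' {W | ∀ x : ι → ℝ, 0 ≤ x ⬝ᵥ (Matrix.of W *ᵥ x)}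
        ∩ {a | (V a).det ≠ 0} := by
    ext a
    simp only [Set.mem_ofPred_eq, Set.mem_inter_iff, Set.mem_preimage]
    constructor
    · intro h
      exact ⟨fun x => star_trivial x ▸ h.posSemidef.dotProduct_mulVec_nonneg x, h.det_pos.ne'⟩
    · rintro ⟨h1, h2⟩
      have : (V a).PosSemidef :=
        Matrix.PosSemidef.of_dotProduct_mulVec_nonneg (hs a) fun x => (star_trivial x).symm ▸ h1 x
      exact this.posDef_iff_det_ne_zero.2 h2
  rw [hset]
  refine (hcont.measurableSet.preimage ?_).inter ?_
  · exact measurable_pi_lambda _ fun i => measurable_pi_lambda _ fun j => hV i j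
  · exact (measurable_matrix_det hV) (measurableSet_singleton 0).compl

lemma measurable_trace_mul_inv_mul {B : α → Matrix ι ι ℝ} (hV : ∀ i j, Measurable fun a => V a i j)
    (hB : ∀ i j, Measurable fun a => B a i j) :
    Measurable fun a => ((V a)⁻¹ * B a).trace := by
  have := measurable_matrix_inv hV
  simp only [Matrix.trace, Matrix.diag, Matrix.mul_apply]
  exact Finset.measurable_sum _ fun i _ => Finset.measurable_sum _ fun j _ =>
    (this i j).mul (hB j i)

lemma measurable_iwKernel (hV : ∀ i j, Measurable fun a => V a i j)
    (hs : ∀ a, (V a).IsHermitian) (Q : Matrix ι ι ℝ) (r : ℝ) :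
    Measurable fun a => iwKernel Q r (V a) := by
  unfold iwKernel
  refine Measurable.ite (measurableSet_posDef hV hs) ?_ measurable_const
  have h1 := measurable_matrix_det hV
  have h2 := measurable_trace_mul_inv_mul hV (B := fun _ => Q) (fun i j => measurable_const)
  fun_prop

end measurability

lemma measurable_symMatrix_apply {d : ℕ} (i j : Fin d) :
    Measurable fun v : UpperIdx d → ℝ => symMatrix v i j := by
  simpa [symMatrix] using measurable_pi_apply _

/-! ### Splitting the coordinates of a symmetric matrix -/

/-- The free entries of a symmetric matrix of size `d + 1`: those of the upper left block, and
those of the last column. -/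
def upperIdxSucc (d : ℕ) : (UpperIdx d ⊕ Fin d) ⊕ Fin 1 ≃ UpperIdx (d + 1) :=
  Equiv.ofBijective
    (Sum.elim (Sum.elim (fun p => ⟨(p.1.1.castSucc, p.1.2.castSucc), by simpa using p.2⟩)
      (fun i => ⟨(i.castSucc, Fin.last d), Fin.le_last _⟩))
      (fun _ => ⟨(Fin.last d, Fin.last d), le_rfl⟩)) (by
    constructor
    · rintro ((⟨⟨i, j⟩, h⟩ | i) | i) ((⟨⟨i', j'⟩, h'⟩ | i') | i') hh <;>
        simp [Fin.ext_iff] at hh ⊢ <;> grind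
    · rintro ⟨⟨i, j⟩, h⟩
      induction j using Fin.lastCases with
      | last =>
        induction i using Fin.lastCases with
        | last => exact ⟨Sum.inr 0, rfl⟩
        | cast i => exact ⟨Sum.inl (Sum.inr i), rfl⟩
      | cast j =>
        induction i using Fin.lastCases with
        | last => simp [Fin.le_def] at h; omega
        | cast i => exact ⟨Sum.inl (Sum.inl ⟨(i, j), by simpa using h⟩), rfl⟩)

/-- Coordinates of the block decomposition of a symmetric matrix of size `d + 1`. -/
def splitEquiv (d : ℕ) :
    ((UpperIdx d → ℝ) × (Fin d → ℝ)) × ℝ ≃ᵐ (UpperIdx (d + 1) → ℝ) :=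
  ((MeasurableEquiv.prodCongr (MeasurableEquiv.sumPiEquivProdPi fun _ => ℝ).symm
    (MeasurableEquiv.funUnique (Fin 1) ℝ).symm).trans
    (MeasurableEquiv.sumPiEquivProdPi fun _ => ℝ).symm).trans
    (MeasurableEquiv.piCongrLeft (fun _ => ℝ) (upperIdxSucc d))

lemma measurePreserving_splitEquiv (d : ℕ) : MeasurePreserving (splitEquiv d) := by
  refine (volume_measurePreserving_piCongrLeft (fun _ => ℝ) (upperIdxSucc d)).comp
    ((volume_measurePreserving_sumPiEquivProdPi_symm fun _ => ℝ).comp ?_)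
  exact (volume_measurePreserving_sumPiEquivProdPi_symm fun _ => ℝ).prod
    ((volume_preserving_funUnique (Fin 1) ℝ).symm)

lemma splitEquiv_apply {d : ℕ} (p : ((UpperIdx d → ℝ) × (Fin d → ℝ)) × ℝ)
    (z : (UpperIdx d ⊕ Fin d) ⊕ Fin 1) :
    splitEquiv d p (upperIdxSucc d z) = Sum.elim (Sum.elim p.1.1 p.1.2) (fun _ => p.2) z := by
  simp only [splitEquiv, MeasurableEquiv.trans_apply]
  rw [MeasurableEquiv.coe_piCongrLeft, Equiv.piCongrLeft_apply_apply]
  rcases z with ((z | z) | z) <;> rfl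

lemma symMatrix_splitEquiv {d : ℕ} (p : ((UpperIdx d → ℝ) × (Fin d → ℝ)) × ℝ) :
    (symMatrix (splitEquiv d p)).submatrix finSumFinEquiv finSumFinEquiv
      = bordered (symMatrix p.1.1) p.1.2 p.2 := by
  have hmk : ∀ (v : UpperIdx (d + 1) → ℝ) (i j : Fin (d + 1)) (z),
      min i j = (upperIdxSucc d z).1.1 → max i j = (upperIdxSucc d z).1.2 → symMatrix v i j = v (upperIdxSucc d z) := by
    intro v i j z h1 h2
    exact congrArg v (Subtype.ext (Prod.ext h1 h2))
  ext i j
  rw [Matrix.submatrix_apply]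
  rcases i with i | i <;> rcases j with j | j
  · rw [hmk _ _ _ (Sum.inl (Sum.inl ⟨(min i j, max i j), min_le_max⟩)), splitEquiv_apply]
    · rfl
    · exact (Fin.strictMono_castSucc.monotone.map_min (a := i) (b := j)).symm
    · exact (Fin.strictMono_castSucc.monotone.map_max (a := i) (b := j)).symm
  · rw [hmk _ _ _ (Sum.inl (Sum.inr i)), splitEquiv_apply]
    · rfl
    · obtain rfl := Subsingleton.elim j 0
      exact min_eq_left (Fin.le_last _)
    · obtain rfl := Subsingleton.elim j 0
      exact max_eq_right (Fin.le_last _)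
  · rw [hmk _ _ _ (Sum.inl (Sum.inr j)), splitEquiv_apply]
    · rfl
    · obtain rfl := Subsingleton.elim i 0
      exact min_eq_right (Fin.le_last _)
    · obtain rfl := Subsingleton.elim i 0
      exact max_eq_left (Fin.le_last _)
  · obtain rfl := Subsingleton.elim i 0
    obtain rfl := Subsingleton.elim j 0
    rw [hmk _ _ _ (Sum.inr 0), splitEquiv_apply]
    · rfl
    · exact min_self _
    · exact max_self _

/-! ### Integrating out the last row and column -/

/-- The inverse Gamma integral. -/
lemma lintegral_rpow_mul_exp_neg_inv {k c : ℝ} (hk : 0 < k) (hc : 0 < c) :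
    ∫⁻ s in Set.Ioi (0 : ℝ), ENNReal.ofReal (s ^ (-(k + 1)) * Real.exp (-(c * s⁻¹)))
      = ENNReal.ofReal (Real.Gamma k / c ^ k) := by
  -- The substitution t = s⁻¹ reduces to the Gamma integral; the right side has the shape of the
  -- change of variables for `p = -1`.
  have hfun : ∀ s ∈ Set.Ioi (0 : ℝ), s ^ (-(k + 1)) * Real.exp (-(c * s⁻¹))
      = (|(-1 : ℝ)| * s ^ ((-1 : ℝ) - 1)) •
        ((s ^ (-1 : ℝ)) ^ (k - 1) * Real.exp (-(c * s ^ (-1 : ℝ)))) := by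
    intro s hs
    have hs' : (0 : ℝ) < s := hs
    rw [smul_eq_mul, ← Real.rpow_mul hs'.le, Real.rpow_neg_one, abs_neg, abs_one, one_mul,
      ← mul_assoc, ← Real.rpow_add hs']
    congr 2
    ring
  have hval := Real.integral_rpow_mul_exp_neg_mul_Ioi hk hc
  have hpos : 0 < Real.Gamma k / c ^ k := div_pos (Real.Gamma_pos_of_pos hk) (by positivity)
  have hint : IntegrableOn (fun t : ℝ => t ^ (k - 1) * Real.exp (-(c * t))) (Set.Ioi 0) := by
    -- A non-integrable function has Bochner integral 0, but the Gamma integral is positive.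
    by_contra h
    rw [integral_undef h] at hval
    have := mul_pos (Real.rpow_pos_of_pos (one_div_pos.2 hc) k) (Real.Gamma_pos_of_pos hk)
    linarith
  have hint' := (integrableOn_Ioi_comp_rpow_iff
    (fun t : ℝ => t ^ (k - 1) * Real.exp (-(c * t))) (p := -1) (by norm_num)).2 hint
  have hcomp := integral_comp_rpow_Ioi
    (fun t : ℝ => t ^ (k - 1) * Real.exp (-(c * t))) (p := -1) (by norm_num)
  rw [setLIntegral_congr_fun measurableSet_Ioi fun s hs => congrArg ENNReal.ofReal (hfun s hs),
    ← ofReal_integral_eq_lintegral_ofReal hint', hcomp, hval]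
  · congr 1
    rw [Real.div_rpow zero_le_one hc.le, Real.one_rpow]
    ring
  · refine (ae_restrict_iff' measurableSet_Ioi).2 (Filter.Eventually.of_forall fun s hs => ?_)
    have hs' : (0 : ℝ) < s := hs
    simp only [Pi.zero_apply, smul_eq_mul]
    positivity

section step

variable {d : ℕ} {C : Matrix (Fin d) (Fin d) ℝ}

lemma schur_add (C : Matrix (Fin d) (Fin d) ℝ) (b : Fin d → ℝ) (s : ℝ) :
    schur C b (s + b ⬝ᵥ (C⁻¹ *ᵥ b)) = s := by
  simp [schur]

lemma iwKernel_bordered_of_pos {Q : Matrix (Fin d) (Fin d) ℝ} (hQ : Q.PosDef) (q : Fin d → ℝ)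
    (q₀ r : ℝ) (hC : C.PosDef) (b : Fin d → ℝ) {s : ℝ} (hs : 0 < s) :
    iwKernel (bordered Q q q₀) r (bordered C b (s + b ⬝ᵥ (C⁻¹ *ᵥ b)))
      = ENNReal.ofReal (C.det ^ (-r) * Real.exp (-(1 / 2) * (C⁻¹ * Q).trace) *
          (s ^ (-r) * Real.exp (-(schur Q q q₀ / 2 * s⁻¹)))) *
        ENNReal.ofReal (Real.exp (-(1 / 2) * ((b - C *ᵥ (Q⁻¹ *ᵥ q)) ⬝ᵥ
          ((s⁻¹ • (C⁻¹ * Q * C⁻¹)) *ᵥ (b - C *ᵥ (Q⁻¹ *ᵥ q)))))) := by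
  have hC0 := hC.det_pos
  rw [iwKernel, if_pos ((posDef_bordered_iff _ _).2 ⟨hC, by rwa [schur_add]⟩),
    det_bordered (isUnit_det_of_posDef hC), trace_inv_bordered_mul hC.isHermitian
      (isUnit_det_of_posDef hC) _ _ (by rw [schur_add]; exact hs.ne') _ _ _ hQ, schur_add,
    ← ENNReal.ofReal_mul (by positivity), Real.mul_rpow hC0.le hs.le]
  congr 1
  rw [mul_add, mul_add, Real.exp_add, Real.exp_add]
  have : -(1 / 2) * (s⁻¹ * schur Q q q₀) = -(schur Q q q₀ / 2 * s⁻¹) := by ring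
  rw [this]
  ring

lemma iwKernel_bordered_of_nonpos (Q : Matrix (Fin d) (Fin d) ℝ) (q : Fin d → ℝ)
    (q₀ r : ℝ) (b : Fin d → ℝ) {s : ℝ} (hs : ¬ 0 < s) :
    iwKernel (bordered Q q q₀) r (bordered C b (s + b ⬝ᵥ (C⁻¹ *ᵥ b))) = 0 := by
  rw [iwKernel, if_neg]
  rw [posDef_bordered_iff, schur_add]
  exact fun h => hs h.2

/-- The Gaussian integral contributes |s⁻¹C⁻¹QC⁻¹|^(-1/2) = s^(d/2) |C| |Q|^(-1/2), which accounts
for the shifts of `r` by 1 and by `d / 2`. -/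
lemma lintegral_iwKernel_bordered_right {Q : Matrix (Fin d) (Fin d) ℝ} (hQ : Q.PosDef)
    (q : Fin d → ℝ) (q₀ r : ℝ) (hC : C.PosDef) {s : ℝ} (hs : 0 < s) :
    ∫⁻ b, iwKernel (bordered Q q q₀) r (bordered C b (s + b ⬝ᵥ (C⁻¹ *ᵥ b)))
      = ENNReal.ofReal (C.det ^ (-(r - 1)) * Real.exp (-(1 / 2) * (C⁻¹ * Q).trace)) *
        ENNReal.ofReal ((2 * Real.pi) ^ ((d : ℝ) / 2) * Q.det ^ (-(1 / 2) : ℝ)) *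
        ENNReal.ofReal (s ^ (-(r - d / 2)) * Real.exp (-(schur Q q q₀ / 2 * s⁻¹))) := by
  have hC0 := hC.det_pos
  have hQ0 := hQ.det_pos
  have hS : (s⁻¹ • (C⁻¹ * Q * C⁻¹)).PosDef := by
    refine Matrix.PosDef.smul ?_ (inv_pos.2 hs)
    have := hQ.conjTranspose_mul_mul_same (B := C⁻¹)
      (Matrix.mulVec_injective_of_isUnit hC.inv.isUnit)
    rwa [hC.inv.isHermitian.eq] at this
  simp_rw [iwKernel_bordered_of_pos hQ q q₀ r hC _ hs]
  rw [lintegral_const_mul' _ _ ENNReal.ofReal_ne_top, lintegral_exp_neg_half_quadForm hS,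
    ← ENNReal.ofReal_mul (by positivity), ← ENNReal.ofReal_mul (by positivity),
    ← ENNReal.ofReal_mul (by positivity)]
  congr 1
  have hdet : (s⁻¹ • (C⁻¹ * Q * C⁻¹)).det = s ^ (-(d : ℝ)) * (C.det ^ (-2 : ℝ) * Q.det) := by
    rw [Matrix.det_smul, Matrix.det_mul, Matrix.det_mul, Matrix.det_nonsing_inv,
      Ring.inverse_eq_inv', Fintype.card_fin, Real.rpow_neg hs.le, Real.rpow_natCast, inv_pow,
      Real.rpow_neg hC0.le, Real.rpow_two]
    field_simp
  rw [hdet, Fintype.card_fin, Real.mul_rpow (x := s ^ (-(d : ℝ))) (by positivity) (by positivity),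
    Real.mul_rpow (x := C.det ^ (-2 : ℝ)) (by positivity) hQ0.le, ← Real.rpow_mul hs.le,
    ← Real.rpow_mul hC0.le]
  have e1 : C.det ^ (-(r - 1)) = C.det ^ (-r) * (C.det ^ ((-2 : ℝ) * (1 / 2)))⁻¹ := by
    rw [← Real.rpow_neg hC0.le, ← Real.rpow_add hC0]
    congr 1
    ring
  have e2 : s ^ (-(r - (d : ℝ) / 2)) = s ^ (-r) * (s ^ (-(d : ℝ) * (1 / 2)))⁻¹ := by
    rw [← Real.rpow_neg hs.le, ← Real.rpow_add hs]
    congr 1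
    ring
  rw [e1, e2, Real.rpow_neg hQ0.le, div_eq_mul_inv (_ ^ _) (_ * _), mul_inv, mul_inv]
  ring

lemma measurable_bordered_apply {α : Type*} [MeasurableSpace α] {c : α → UpperIdx d → ℝ}
    {b : α → Fin d → ℝ} {a : α → ℝ} (hc : Measurable c) (hb : Measurable b) (ha : Measurable a)
    (i j : Fin d ⊕ Fin 1) :
    Measurable fun t => bordered (symMatrix (c t)) (b t) (a t) i j := by
  rcases i with i | i <;> rcases j with j | j <;> simp only [bordered, Matrix.fromBlocks_apply₁₁,
    Matrix.fromBlocks_apply₁₂, Matrix.fromBlocks_apply₂₁, Matrix.fromBlocks_apply₂₂]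
  · exact (measurable_symMatrix_apply i j).comp hc
  · exact (measurable_pi_apply i).comp hb
  · exact (measurable_pi_apply j).comp hb
  · exact ha

lemma bordered_isHermitian (hC : C.IsHermitian) (b : Fin d → ℝ) (a : ℝ) :
    (bordered C b a).IsHermitian := by
  refine hC.fromBlocks ?_ ?_
  · rw [Matrix.conjTranspose_eq_transpose_of_trivial, Matrix.transpose_replicateCol]
  · ext i j
    simp

lemma measurable_iwKernel_bordered {α : Type*} [MeasurableSpace α] {c : α → UpperIdx d → ℝ}
    {b : α → Fin d → ℝ} {a : α → ℝ} (hc : Measurable c) (hb : Measurable b) (ha : Measurable a)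
    (Q : Matrix (Fin d ⊕ Fin 1) (Fin d ⊕ Fin 1) ℝ) (r : ℝ) :
    Measurable fun t => iwKernel Q r (bordered (symMatrix (c t)) (b t) (a t)) :=
  measurable_iwKernel (fun i j => measurable_bordered_apply hc hb ha i j)
    (fun _ => bordered_isHermitian (symMatrix_isHermitian _) _ _) Q r

/-- The induction step: with r = (n+d+2)/2, the exponent r - 1 is that of size `d` and `n - 1`
degrees of freedom, and r - d/2 = n/2 + 1 gives an inverse Gamma integral of shape n/2. -/
lemma lintegral_lintegral_iwKernel_bordered {Q : Matrix (Fin d) (Fin d) ℝ} {q : Fin d → ℝ}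
    {q₀ : ℝ} (hQ : (bordered Q q q₀).PosDef) {n : ℝ} (hn : 0 < n) (c : UpperIdx d → ℝ) :
    ∫⁻ b, ∫⁻ a, iwKernel (bordered Q q q₀) ((n + (d + 1) + 1) / 2) (bordered (symMatrix c) b a)
      = iwKernel Q ((n - 1 + d + 1) / 2) (symMatrix c) *
        ENNReal.ofReal ((2 * Real.pi) ^ ((d : ℝ) / 2) * Q.det ^ (-(1 / 2) : ℝ) *
          (Real.Gamma (n / 2) / (schur Q q q₀ / 2) ^ (n / 2))) := by
  obtain ⟨hQ', hσ⟩ := (posDef_bordered_iff _ _).1 hQ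
  have hQ0 := hQ'.det_pos
  set r : ℝ := (n + (d + 1) + 1) / 2 with hr
  by_cases hC : (symMatrix c).PosDef
  swap
  · rw [iwKernel, if_neg hC, zero_mul]
    have : ∀ b a, iwKernel (bordered Q q q₀) r (bordered (symMatrix c) b a) = 0 := by
      intro b a
      rw [iwKernel, if_neg]
      rw [posDef_bordered_iff]
      exact fun h => hC h.1
    simp [this]
  -- Translation invariance makes the Schur complement `s` the variable in place of the corner
  -- entry, with no Jacobian; then `b` can be integrated first.
  have hshift : ∀ b, ∫⁻ a, iwKernel (bordered Q q q₀) r (bordered (symMatrix c) b a)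
      = ∫⁻ s, iwKernel (bordered Q q q₀) r
        (bordered (symMatrix c) b (s + b ⬝ᵥ ((symMatrix c)⁻¹ *ᵥ b))) := fun b =>
    (lintegral_add_right_eq_self
      (fun a => iwKernel (bordered Q q q₀) r (bordered (symMatrix c) b a)) _).symm
  simp_rw [hshift]
  rw [lintegral_lintegral_swap]
  swap
  · refine (measurable_iwKernel_bordered measurable_const measurable_fst ?_ _ _).aemeasurable
    simp only [dotProduct, Matrix.mulVec]
    fun_prop
  have hs : ∀ s : ℝ, ∫⁻ b, iwKernel (bordered Q q q₀) r
        (bordered (symMatrix c) b (s + b ⬝ᵥ ((symMatrix c)⁻¹ *ᵥ b)))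
      = (Set.Ioi (0 : ℝ)).indicator (fun s =>
        ENNReal.ofReal ((symMatrix c).det ^ (-(r - 1)) *
          Real.exp (-(1 / 2) * ((symMatrix c)⁻¹ * Q).trace)) *
        ENNReal.ofReal ((2 * Real.pi) ^ ((d : ℝ) / 2) * Q.det ^ (-(1 / 2) : ℝ)) *
        ENNReal.ofReal (s ^ (-(r - d / 2)) * Real.exp (-(schur Q q q₀ / 2 * s⁻¹)))) s := by
    intro s
    by_cases h : 0 < s
    · rw [Set.indicator_of_mem (Set.mem_Ioi.2 h), lintegral_iwKernel_bordered_right hQ' _ _ _ hC h]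
    · rw [Set.indicator_of_notMem (by simpa using h)]
      simp_rw [iwKernel_bordered_of_nonpos Q q q₀ r _ h]
      simp
  simp_rw [hs]
  rw [lintegral_indicator measurableSet_Ioi, lintegral_const_mul' _ _
    (ENNReal.mul_ne_top ENNReal.ofReal_ne_top ENNReal.ofReal_ne_top)]
  have e1 : r - (d : ℝ) / 2 = n / 2 + 1 := by rw [hr]; ring
  have e2 : r - 1 = (n - 1 + d + 1) / 2 := by rw [hr]; ring
  rw [e1, lintegral_rpow_mul_exp_neg_inv (by positivity) (by positivity), iwKernel, if_pos hC,
    e2, mul_assoc, ← ENNReal.ofReal_mul (by positivity)]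

end step

/-! ### Normalisation of the inverse Wishart density -/

lemma exists_eq_bordered {d : ℕ} {Q : Matrix (Fin d ⊕ Fin 1) (Fin d ⊕ Fin 1) ℝ}
    (hQ : Q.IsHermitian) : ∃ Q' q q₀, Q = bordered Q' q q₀ := by
  refine ⟨Q.toBlocks₁₁, fun i => Q (Sum.inl i) (Sum.inr 0), Q (Sum.inr 0) (Sum.inr 0), ?_⟩
  ext (i | i) (j | j)
  · rfl
  · obtain rfl := Subsingleton.elim j 0
    rfl
  · obtain rfl := Subsingleton.elim i 0
    exact (hQ.apply (Sum.inr 0) (Sum.inl j)).symm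
  · obtain rfl := Subsingleton.elim i 0
    obtain rfl := Subsingleton.elim j 0
    rfl

lemma iwConst_succ (n : ℝ) (d : ℕ) :
    iwConst n (d + 1) = Real.pi ^ ((d : ℝ) / 2) * Real.Gamma (n / 2) * iwConst (n - 1) d := by
  unfold iwConst
  rw [Fin.prod_univ_succ]
  have h1 : Real.pi ^ (((d + 1 : ℕ) : ℝ) * (((d + 1 : ℕ) : ℝ) - 1) / 4)
      = Real.pi ^ ((d : ℝ) / 2) * Real.pi ^ ((d : ℝ) * ((d : ℝ) - 1) / 4) := by
    rw [← Real.rpow_add Real.pi_pos]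
    congr 1
    push_cast
    ring
  have h2 : ∀ i : Fin d, (n - ((i.succ : Fin (d + 1)) : ℕ)) / 2 = (n - 1 - (i : ℕ)) / 2 := by
    intro i
    push_cast [Fin.val_succ]
    ring
  simp_rw [h1, h2]
  simp
  ring

lemma iwConst_pos {n : ℝ} {d : ℕ} (hn : (d : ℝ) - 1 < n) : 0 < iwConst n d := by
  refine mul_pos (Real.rpow_pos_of_pos Real.pi_pos _)
    (Finset.prod_pos fun i _ => Real.Gamma_pos_of_pos ?_)
  have : ((i : ℕ) : ℝ) + 1 ≤ d := by exact_mod_cast i.2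
  linarith

/-- The normalisation of the inverse Wishart density. -/
theorem lintegral_iwKernel (d : ℕ) : ∀ (n : ℝ), (d : ℝ) - 1 < n →
    ∀ Q : Matrix (Fin d) (Fin d) ℝ, Q.PosDef →
    ∫⁻ v : UpperIdx d → ℝ, iwKernel Q ((n + d + 1) / 2) (symMatrix v)
      = ENNReal.ofReal (2 ^ (n * d / 2) * iwConst n d * Q.det ^ (-(n / 2))) := by
  induction d with
  | zero =>
    intro n _ Q _
    -- For `d = 0` the coordinate space is a single point of volume 1, and the empty matrix is
    -- positive definite.
    have h : ∀ v : UpperIdx 0 → ℝ, iwKernel Q ((n + (0 : ℕ) + 1) / 2) (symMatrix v) = 1 := by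
      intro v
      rw [iwKernel, if_pos]
      · simp [Matrix.trace]
      · exact Matrix.PosDef.of_dotProduct_mulVec_pos (symMatrix_isHermitian v)
          fun x hx => (hx (Subsingleton.elim _ _)).elim
    simp_rw [h]
    simp [iwConst, volume_pi]
  | succ d ih =>
    intro n hn Q hQ
    push_cast at hn
    have hn0 : 0 < n := by
      have : (0 : ℝ) ≤ d := Nat.cast_nonneg d
      linarith
    have hQs := (posDef_submatrix_equiv_iff (finSumFinEquiv (m := d) (n := 1)) Q).2 hQ
    obtain ⟨Q', q, q₀, hQ'⟩ := exists_eq_bordered hQs.isHermitian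
    rw [hQ'] at hQs
    obtain ⟨hQp, hσ⟩ := (posDef_bordered_iff _ _).1 hQs
    have hQ0 := hQp.det_pos
    have hdet : Q.det = Q'.det * schur Q' q q₀ := by
      rw [← det_bordered (isUnit_det_of_posDef hQp), ← hQ', Matrix.det_submatrix_equiv_self]
    have hmeas := measurable_iwKernel_bordered (d := d)
      (c := fun p : ((UpperIdx d → ℝ) × (Fin d → ℝ)) × ℝ => p.1.1) (b := fun p => p.1.2)
      (a := fun p => p.2) (by fun_prop) (by fun_prop) (by fun_prop)
      (bordered Q' q q₀) ((n + (d + 1) + 1) / 2)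
    rw [← (measurePreserving_splitEquiv d).lintegral_comp_emb
      (splitEquiv d).measurableEmbedding]
    simp_rw [← iwKernel_submatrix (finSumFinEquiv (m := d) (n := 1)) Q, symMatrix_splitEquiv, hQ']
    push_cast
    rw [Measure.volume_eq_prod, lintegral_prod _ hmeas.aemeasurable, Measure.volume_eq_prod,
      lintegral_prod _ hmeas.lintegral_prod_right'.aemeasurable]
    simp only
    simp_rw [lintegral_lintegral_iwKernel_bordered hQs hn0]
    rw [lintegral_mul_const' _ _ ENNReal.ofReal_ne_top, ih (n - 1) (by linarith) Q' hQp,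
      ← ENNReal.ofReal_mul' (by
        have := Real.Gamma_pos_of_pos (half_pos hn0)
        positivity)]
    congr 1
    rw [iwConst_succ, hdet, Real.mul_rpow hQ0.le hσ.le, Real.div_rpow hσ.le zero_le_two,
      Real.mul_rpow zero_le_two Real.pi_pos.le]
    -- The powers of 2 come from the induction hypothesis, from (2π)^(d/2), and from the rate σ/2 of
    -- the inverse Gamma integral, where σ is the Schur complement.
    have e1 : (2 : ℝ) ^ (n * (d + 1) / 2)
        = 2 ^ ((n - 1) * d / 2) * 2 ^ ((d : ℝ) / 2) * 2 ^ (n / 2) := by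
      rw [← Real.rpow_add two_pos, ← Real.rpow_add two_pos]
      congr 1
      ring
    have e2 : Q'.det ^ (-(n / 2)) = Q'.det ^ (-((n - 1) / 2)) * Q'.det ^ (-(1 / 2) : ℝ) := by
      rw [← Real.rpow_add hQ0]
      congr 1
      ring
    rw [e1, e2, Real.rpow_neg hσ.le]
    have hs : schur Q' q q₀ ^ (n / 2) ≠ 0 := (Real.rpow_pos_of_pos hσ _).ne'
    field_simp

/-! ### The prior as an exponential family -/

/-- The matrix that is paired with `V⁻¹` in the exponent of the prior density. -/
def scatter {d m : ℕ} (M : Matrix (Fin d) (Fin m) ℝ) (K : Matrix (Fin m) (Fin m) ℝ)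
    (Q : Matrix (Fin d) (Fin d) ℝ) (A : Matrix (Fin d) (Fin m) ℝ) : Matrix (Fin d) (Fin d) ℝ :=
  Q + (A - M) * K * (A - M)ᵀ

/-- The normalising constant of the prior density. -/
def priorConst {d m : ℕ} (K : Matrix (Fin m) (Fin m) ℝ) (Q : Matrix (Fin d) (Fin d) ℝ) (n : ℝ) :
    ℝ :=
  K.det ^ ((d : ℝ) / 2) * Q.det ^ (n / 2) *
    ((2 * Real.pi) ^ ((d : ℝ) * m / 2) * (2 ^ (n * d / 2) * iwConst n d))⁻¹

section prior

variable {d m : ℕ} {M : Matrix (Fin d) (Fin m) ℝ} {K : Matrix (Fin m) (Fin m) ℝ}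
  {Q : Matrix (Fin d) (Fin d) ℝ} {n : ℝ}

lemma priorConst_pos (hK : K.PosDef) (hQ : Q.PosDef) (hn : (d : ℝ) - 1 < n) :
    0 < priorConst K Q n := by
  have := iwConst_pos hn
  have := hK.det_pos
  have := hQ.det_pos
  unfold priorConst
  positivity

lemma trace_inv_mul_scatter (V : Matrix (Fin d) (Fin d) ℝ) (A : Matrix (Fin d) (Fin m) ℝ) :
    (V⁻¹ * scatter M K Q A).trace
      = ((A - M)ᵀ * V⁻¹ * (A - M) * K).trace + (V⁻¹ * Q).trace := by
  rw [scatter, Matrix.mul_add, Matrix.trace_add, add_comm, ← Matrix.mul_assoc,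
    Matrix.trace_mul_comm, ← Matrix.mul_assoc, ← Matrix.mul_assoc]

lemma priorDensity_of_not_posDef {θ : Param d m} (hV : ¬ θ.V.PosDef) :
    priorDensity M K Q n θ = 0 := by
  rw [priorDensity, invWishartDensity, if_neg hV, mul_zero]

lemma det_smul_rpow {V : Matrix (Fin d) (Fin d) ℝ} (hV : V.PosDef) {c : ℝ} (hc : 0 < c) (t : ℝ) :
    (c • V).det ^ t = c ^ (d * t) * V.det ^ t := by
  rw [Matrix.det_smul, Fintype.card_fin, Real.mul_rpow (by positivity) hV.det_pos.le,
    ← Real.rpow_natCast, ← Real.rpow_mul hc.le]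

/-- The exponent of |V| collects n/2 from |V⁻¹Q/2|, (d+1)/2 from the inverse Wishart factor, and m/2
from the matrix normal factor. -/
lemma priorDensity_of_posDef (hQ : Q.PosDef) {θ : Param d m} (hV : θ.V.PosDef) :
    priorDensity M K Q n θ = priorConst K Q n * (θ.V.det ^ (-((n + d + 1 + m) / 2)) *
      Real.exp (-(1 / 2) * (θ.V⁻¹ * scatter M K Q θ.A).trace)) := by
  have hV0 := hV.det_pos
  have hQ0 := hQ.det_pos
  rw [priorDensity, matrixNormalDensity, invWishartDensity, if_pos hV, trace_inv_mul_scatter,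
    mul_add, Real.exp_add, det_smul_rpow hV (by positivity), priorConst]
  have e1 : ((1 / 2 : ℝ) • (θ.V⁻¹ * Q)).det ^ (n / 2)
      = (2 ^ (n * d / 2))⁻¹ * (θ.V.det ^ (-(n / 2)) * Q.det ^ (n / 2)) := by
    rw [Matrix.det_smul, Matrix.det_mul, Matrix.det_nonsing_inv, Ring.inverse_eq_inv',
      Fintype.card_fin, Real.mul_rpow (by positivity) (by positivity),
      Real.mul_rpow (by positivity) hQ0.le, Real.inv_rpow hV0.le, ← Real.rpow_neg hV0.le,
      ← Real.rpow_natCast, ← Real.rpow_mul (by positivity), one_div, Real.inv_rpow zero_le_two]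
    congr 3
    ring
  have e2 : θ.V.det ^ (-((n + d + 1 + m) / 2)) = θ.V.det ^ (-(n / 2)) *
      (θ.V.det ^ (((d : ℝ) + 1) / 2))⁻¹ * (θ.V.det ^ ((m : ℝ) / 2))⁻¹ := by
    rw [← Real.rpow_neg hV0.le, ← Real.rpow_neg hV0.le, ← Real.rpow_add hV0, ← Real.rpow_add hV0]
    congr 1
    ring
  rw [e1, e2, mul_div_assoc (d : ℝ)]
  simp only [div_eq_mul_inv, mul_inv]
  ring

lemma priorDensity_nonneg (hK : K.PosDef) (hQ : Q.PosDef) (hn : (d : ℝ) - 1 < n)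
    (θ : Param d m) : 0 ≤ priorDensity M K Q n θ := by
  by_cases hV : θ.V.PosDef
  · rw [priorDensity_of_posDef hQ hV]
    have := priorConst_pos hK hQ hn
    have := hV.det_pos
    positivity
  · rw [priorDensity_of_not_posDef hV]

lemma measurable_priorDensity (hQ : Q.PosDef) : Measurable (priorDensity M K Q n) := by
  classical
  have hVm : ∀ i j, Measurable fun θ : Param d m => θ.V i j := fun i j =>
    (measurable_symMatrix_apply i j).comp measurable_snd
  have hS : ∀ i j, Measurable fun θ : Param d m => scatter M K Q θ.A i j := by
    intro i j
    have hA : ∀ k l, Measurable fun θ : Param d m => θ.A k l := fun k l =>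
      (measurable_pi_apply l).comp ((measurable_pi_apply k).comp measurable_fst)
    simp only [scatter, Matrix.add_apply, Matrix.mul_apply, Matrix.sub_apply,
      Matrix.transpose_apply]
    fun_prop
  have h : priorDensity M K Q n = fun θ => if θ.V.PosDef then priorConst K Q n *
      (θ.V.det ^ (-((n + d + 1 + m) / 2)) *
        Real.exp (-(1 / 2) * (θ.V⁻¹ * scatter M K Q θ.A).trace)) else 0 := by
    ext θ
    split_ifs with hV
    · exact priorDensity_of_posDef hQ hV
    · exact priorDensity_of_not_posDef hV
  rw [h]
  refine Measurable.ite (measurableSet_posDef hVm fun θ => symMatrix_isHermitian _) ?_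
    measurable_const
  have h1 := measurable_matrix_det hVm
  have h2 := measurable_trace_mul_inv_mul hVm hS
  fun_prop

/-- The matrix normal factor integrates out. -/
lemma lintegral_priorDensity_left (hK : K.PosDef) (hQ : Q.PosDef) (hn : (d : ℝ) - 1 < n)
    (v : UpperIdx d → ℝ) :
    ∫⁻ A : Fin d → Fin m → ℝ, ENNReal.ofReal (priorDensity M K Q n (A, v))
      = ENNReal.ofReal (Q.det ^ (n / 2) * (2 ^ (n * d / 2) * iwConst n d)⁻¹) *
        iwKernel Q ((n + d + 1) / 2) (symMatrix v) := by
  have hK0 := hK.det_pos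
  have hQ0 := hQ.det_pos
  have hc := priorConst_pos hK hQ hn
  have hZ := iwConst_pos hn
  by_cases hV : (symMatrix v).PosDef
  · have hV0 := hV.det_pos
    have h : ∀ A : Fin d → Fin m → ℝ, ENNReal.ofReal (priorDensity M K Q n (A, v))
        = ENNReal.ofReal (priorConst K Q n * (symMatrix v).det ^ (-((n + d + 1 + m) / 2)) *
            Real.exp (-(1 / 2) * ((symMatrix v)⁻¹ * Q).trace)) *
          ENNReal.ofReal (Real.exp (-(1 / 2) *
            ((Matrix.of A - M)ᵀ * (symMatrix v)⁻¹ * (Matrix.of A - M) * K).trace)) := by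
      intro A
      rw [priorDensity_of_posDef (θ := (A, v)) hQ hV, trace_inv_mul_scatter,
        ← ENNReal.ofReal_mul (by positivity), mul_add, Real.exp_add, Param.V, Param.A]
      congr 1
      ring
    simp_rw [h]
    rw [lintegral_const_mul' _ _ ENNReal.ofReal_ne_top, lintegral_exp_neg_half_trace hV.inv hK,
      iwKernel, if_pos hV, ← ENNReal.ofReal_mul (by positivity),
      ← ENNReal.ofReal_mul (by positivity), Matrix.det_nonsing_inv, Ring.inverse_eq_inv',
      Fintype.card_fin, Fintype.card_fin, Real.inv_rpow hV0.le, priorConst]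
    congr 1
    have e : (symMatrix v).det ^ (-((n + d + 1 + m) / 2))
        = (symMatrix v).det ^ (-((n + d + 1) / 2)) * ((symMatrix v).det ^ ((m : ℝ) / 2))⁻¹ := by
      rw [← Real.rpow_neg hV0.le, ← Real.rpow_add hV0]
      congr 1
      ring
    rw [e]
    have h1 : K.det ^ ((d : ℝ) / 2) ≠ 0 := by positivity
    have h2 : (symMatrix v).det ^ ((m : ℝ) / 2) ≠ 0 := by positivity
    have h3 : (2 * Real.pi) ^ ((d : ℝ) * m / 2) ≠ 0 := by positivity
    generalize (2 * Real.pi) ^ ((d : ℝ) * m / 2) = w at *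
    field_simp
  · rw [iwKernel, if_neg hV, mul_zero]
    have h : ∀ A : Fin d → Fin m → ℝ, priorDensity M K Q n (A, v) = 0 := fun A =>
      priorDensity_of_not_posDef hV
    simp [h]

theorem lintegral_priorDensity (hK : K.PosDef) (hQ : Q.PosDef) (hn : (d : ℝ) - 1 < n) :
    ∫⁻ θ : Param d m, ENNReal.ofReal (priorDensity M K Q n θ) = 1 := by
  have hQ0 := hQ.det_pos
  have hZ := iwConst_pos hn
  rw [Measure.volume_eq_prod, lintegral_prod_symm _
    (measurable_priorDensity hQ).ennreal_ofReal.aemeasurable]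
  simp_rw [lintegral_priorDensity_left hK hQ hn]
  rw [lintegral_const_mul' _ _ ENNReal.ofReal_ne_top, lintegral_iwKernel d n hn Q hQ,
    ← ENNReal.ofReal_mul (by positivity), ← ENNReal.ofReal_one, Real.rpow_neg hQ0.le]
  congr 1
  have h1 : Q.det ^ (n / 2) ≠ 0 := by positivity
  field_simp

theorem isProbDensity_priorDensity (hK : K.PosDef) (hQ : Q.PosDef) (hn : (d : ℝ) - 1 < n) :
    IsProbDensity volume (priorDensity M K Q n) := by
  have h0 := priorDensity_nonneg (M := M) hK hQ hn
  have h1 := lintegral_priorDensity (M := M) hK hQ hn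
  have hm := (measurable_priorDensity (M := M) (K := K) (n := n) hQ).aestronglyMeasurable
    (μ := volume)
  refine ⟨h0, ?_, ?_⟩
  · refine ⟨hm, ?_⟩
    rw [hasFiniteIntegral_iff_ofReal (Filter.Eventually.of_forall h0), h1]
    exact ENNReal.one_lt_top
  · rw [integral_eq_lintegral_of_nonneg_ae (Filter.Eventually.of_forall h0) hm, h1,
      ENNReal.toReal_one]

/-! ### Powers of the prior density -/

lemma scatter_smul (s : ℝ) (A : Matrix (Fin d) (Fin m) ℝ) :
    scatter M (s • K) (s • Q) A = s • scatter M K Q A := by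
  simp [scatter, smul_add]

/-- The powers of a prior density are proportional to prior densities. -/
lemma priorDensity_rpow (hK : K.PosDef) (hQ : Q.PosDef) (hn : (d : ℝ) - 1 < n) {s : ℝ}
    (hs : 0 < s) {n' : ℝ} (hn' : n' = (m + d + 1 + n) * s - (m + d + 1)) (hd : (d : ℝ) - 1 < n')
    (θ : Param d m) :
    priorDensity M K Q n θ ^ s = priorConst K Q n ^ s / priorConst (s • K) (s • Q) n' *
      priorDensity M (s • K) (s • Q) n' θ := by
  by_cases hV : θ.V.PosDef
  · have hc := priorConst_pos hK hQ hn
    have hc' := priorConst_pos (hK.smul hs) (hQ.smul hs) hd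
    have hV0 := hV.det_pos
    -- `n'` is the solution of n' + d + 1 + m = s(n + d + 1 + m), which matches the powers of |V|.
    rw [priorDensity_of_posDef hQ hV, priorDensity_of_posDef (hQ.smul hs) hV, scatter_smul,
      Matrix.mul_smul, Matrix.trace_smul, Real.mul_rpow hc.le (by positivity),
      Real.mul_rpow (by positivity) (by positivity), ← Real.rpow_mul hV0.le, ← Real.exp_mul,
      ← mul_assoc (_ / _), div_mul_cancel₀ _ hc'.ne', hn', smul_eq_mul]
    congr 3 <;> ring
  · rw [priorDensity_of_not_posDef hV, priorDensity_of_not_posDef hV, Real.zero_rpow hs.ne',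
      mul_zero]

/-- Isolates the dependence on `K` and `Q`. The exponent of |Q| is (ns - n')/2, and ns - n' =
(m+d+1)(1-s). -/
lemma priorConst_rpow_div (hK : K.PosDef) (hQ : Q.PosDef) (hn : (d : ℝ) - 1 < n) {s : ℝ}
    (hs : 0 < s) {n' : ℝ} (hn' : n' = (m + d + 1 + n) * s - (m + d + 1)) (hd : (d : ℝ) - 1 < n') :
    priorConst K Q n ^ s / priorConst (s • K) (s • Q) n'
      = (K.det ^ (-((d : ℝ) / 2)) * Q.det ^ (((m : ℝ) + d + 1) / 2)) ^ (1 - s) *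
        (priorConst (1 : Matrix (Fin m) (Fin m) ℝ) (1 : Matrix (Fin d) (Fin d) ℝ) n ^ s /
          priorConst (s • (1 : Matrix (Fin m) (Fin m) ℝ)) (s • (1 : Matrix (Fin d) (Fin d) ℝ))
            n') := by
  have hK0 := hK.det_pos
  have hQ0 := hQ.det_pos
  have hZ := iwConst_pos hn
  have hZ' := iwConst_pos hd
  unfold priorConst
  rw [det_smul_rpow hK hs, det_smul_rpow hQ hs, det_smul_rpow Matrix.PosDef.one hs,
    det_smul_rpow Matrix.PosDef.one hs, Matrix.det_one, Matrix.det_one, Real.one_rpow,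
    Real.one_rpow, Real.one_rpow, Real.mul_rpow (by positivity) (by positivity),
    Real.mul_rpow (x := K.det ^ ((d : ℝ) / 2)) (by positivity) (by positivity),
    Real.mul_rpow (x := K.det ^ (-((d : ℝ) / 2))) (by positivity) (by positivity),
    ← Real.rpow_mul hK0.le, ← Real.rpow_mul hK0.le, ← Real.rpow_mul hQ0.le,
    ← Real.rpow_mul hQ0.le, one_mul, one_mul]
  have e1 : K.det ^ ((d : ℝ) / 2 * s)
      = K.det ^ (-((d : ℝ) / 2) * (1 - s)) * K.det ^ ((d : ℝ) / 2) := by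
    rw [← Real.rpow_add hK0]
    congr 1
    ring
  have e2 : Q.det ^ (n / 2 * s)
      = Q.det ^ (((m : ℝ) + d + 1) / 2 * (1 - s)) * Q.det ^ (n' / 2) := by
    rw [← Real.rpow_add hQ0, hn']
    congr 1
    ring
  rw [e1, e2]
  generalize (2 * Real.pi) ^ ((d : ℝ) * m / 2) * (2 ^ (n * d / 2) * iwConst n d) = w
  have h3 : (2 * Real.pi) ^ ((d : ℝ) * m / 2) * (2 ^ (n' * d / 2) * iwConst n' d) ≠ 0 := by
    positivity
  generalize (2 * Real.pi) ^ ((d : ℝ) * m / 2) * (2 ^ (n' * d / 2) * iwConst n' d) = w' at *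
  have h1 : K.det ^ ((d : ℝ) / 2) ≠ 0 := by positivity
  have h2 : Q.det ^ (n' / 2) ≠ 0 := by positivity
  field_simp

end prior

/-! ### Entropy as a derivative of the integrals of powers -/

/-- If the powers `p ^ (1 + t)` of a nonnegative function are integrable for small `t`, then
`p log p` is integrable, and its integral is the derivative of `t ↦ ∫ p ^ (1 + t)` at `0`. -/
lemma hasDerivAt_integral_rpow {Ω : Type*} [MeasurableSpace Ω] {ν : Measure Ω} {p : Ω → ℝ}
    (hp : Measurable p) (h0 : ∀ ω, 0 ≤ p ω)
    (hint : ∀ᶠ t in nhds (0 : ℝ), Integrable (fun ω => p ω ^ (1 + t)) ν) :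
    Integrable (fun ω => p ω * Real.log (p ω)) ν ∧
      HasDerivAt (fun t => ∫ ω, p ω ^ (1 + t) ∂ν) (∫ ω, p ω * Real.log (p ω) ∂ν) (0 : ℝ) := by
  -- Under `μ`, the integral of p^(1+t) is the moment generating function of log p at `t`, so
  -- integrability and differentiability at 0 come from the theory of that function.
  set μ := ν.withDensity fun ω => ENNReal.ofReal (p ω)
  have hpm : Measurable fun ω => ENNReal.ofReal (p ω) := hp.ennreal_ofReal
  have hlt : ∀ᵐ ω ∂ν, ENNReal.ofReal (p ω) < ⊤ := by simp
  have hmul : ∀ (f : Ω → ℝ) ω, (ENNReal.ofReal (p ω)).toReal • f ω = p ω * f ω := fun f ω => by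
    rw [ENNReal.toReal_ofReal (h0 ω), smul_eq_mul]
  have hI : ∀ f : Ω → ℝ, Integrable f μ ↔ Integrable (fun ω => p ω * f ω) ν := fun f => by
    rw [integrable_withDensity_iff_integrable_smul' hpm hlt]
    simp_rw [hmul]
  have hE : ∀ f : Ω → ℝ, ∫ ω, f ω ∂μ = ∫ ω, p ω * f ω ∂ν := fun f => by
    rw [integral_withDensity_eq_integral_toReal_smul hpm hlt]
    simp_rw [hmul]
  -- Where `p` vanishes the left side is 0, so the exponent must avoid 0, since `0 ^ 0 = 1`.
  have hexp : ∀ t : ℝ, 1 + t ≠ 0 → ∀ ω,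
      p ω * Real.exp (t * Real.log (p ω)) = p ω ^ (1 + t) := by
    intro t ht ω
    rcases (h0 ω).eq_or_lt with h | h
    · rw [← h, zero_mul, Real.zero_rpow ht]
    · rw [Real.rpow_add h, Real.rpow_one, mul_comm t, Real.rpow_def_of_pos h]
  have hne : ∀ᶠ t in nhds (0 : ℝ), 1 + t ≠ 0 :=
    (Continuous.tendsto (by fun_prop : Continuous fun t : ℝ => 1 + t) 0).eventually_ne (by simp)
  have hmem : 0 ∈ interior (ProbabilityTheory.integrableExpSet (fun ω => Real.log (p ω)) μ) := by
    rw [mem_interior_iff_mem_nhds]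
    filter_upwards [hint, hne] with t h1 h2
    change Integrable _ μ
    rw [hI]
    simpa only [hexp t h2] using h1
  refine ⟨(hI _).1 (ProbabilityTheory.integrable_of_mem_interior_integrableExpSet hmem), ?_⟩
  have hd := ProbabilityTheory.hasDerivAt_mgf hmem
  simp only [zero_mul, Real.exp_zero, mul_one] at hd
  rw [hE] at hd
  refine hd.congr_of_eventuallyEq ?_
  filter_upwards [hne] with t ht
  rw [ProbabilityTheory.mgf, hE]
  simp only [hexp t ht]

section entropy

variable {d m : ℕ} {M : Matrix (Fin d) (Fin m) ℝ} {K : Matrix (Fin m) (Fin m) ℝ}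
  {Q : Matrix (Fin d) (Fin d) ℝ} {n : ℝ}

/-- The entropy of the standard prior with `M = 0`, `K = 1` and `Q = 1`. -/
def standardEntropy (d m : ℕ) (n : ℝ) : ℝ :=
  -∫ θ : Param d m, priorDensity 0 1 1 n θ * Real.log (priorDensity 0 1 1 n θ)

/-- Both powers are multiples of densities of mass one, so only the constants are compared; in
particular `M` drops out. -/
lemma integral_priorDensity_rpow (hK : K.PosDef) (hQ : Q.PosDef) (hn : (d : ℝ) - 1 < n) {s : ℝ}
    (hs : 0 < s) (hd : (d : ℝ) - 1 < (m + d + 1 + n) * s - (m + d + 1)) :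
    Integrable (fun θ => priorDensity M K Q n θ ^ s) ∧
      ∫ θ, priorDensity M K Q n θ ^ s
        = (K.det ^ (-((d : ℝ) / 2)) * Q.det ^ (((m : ℝ) + d + 1) / 2)) ^ (1 - s) *
          ∫ θ : Param d m, priorDensity 0 1 1 n θ ^ s := by
  have hp := isProbDensity_priorDensity (M := M) (hK.smul hs) (hQ.smul hs) hd
  have hp₁ := isProbDensity_priorDensity (M := (0 : Matrix (Fin d) (Fin m) ℝ))
    (Matrix.PosDef.one.smul hs) (Matrix.PosDef.one.smul hs) hd
  simp_rw [priorDensity_rpow hK hQ hn hs rfl hd,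
    priorDensity_rpow Matrix.PosDef.one Matrix.PosDef.one hn hs rfl hd]
  refine ⟨hp.integrable.const_mul _, ?_⟩
  rw [integral_const_mul, integral_const_mul, hp.integral_eq_one, hp₁.integral_eq_one, mul_one,
    mul_one, priorConst_rpow_div hK hQ hn hs rfl hd]

theorem hasEntropy_priorDensity (hK : K.PosDef) (hQ : Q.PosDef) (hn : (d : ℝ) - 1 < n) :
    HasEntropy volume (priorDensity M K Q n) (-((d : ℝ) / 2) * Real.log K.det
      + (((m : ℝ) + d + 1) / 2) * Real.log Q.det + standardEntropy d m n) := by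
  have hK0 := hK.det_pos
  have hQ0 := hQ.det_pos
  -- At t = 0 these read 0 < 1 and d - 1 < n; strictness makes them persist nearby.
  have hev : ∀ᶠ t in nhds (0 : ℝ), 0 < 1 + t ∧
      (d : ℝ) - 1 < (m + d + 1 + n) * (1 + t) - (m + d + 1) := by
    refine Filter.Eventually.and ?_ ?_
    · exact (Continuous.tendsto (by fun_prop : Continuous fun t : ℝ => 1 + t) 0).eventually_const_lt
        (by simp)
    · exact (Continuous.tendsto (by fun_prop : Continuous fun t : ℝ =>
        (m + d + 1 + n) * (1 + t) - (m + d + 1)) 0).eventually_const_lt (by simpa using hn)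
  obtain ⟨hi, hd⟩ := hasDerivAt_integral_rpow (ν := volume)
    (measurable_priorDensity (M := M) (K := K) (n := n) hQ) (priorDensity_nonneg hK hQ hn)
    (hev.mono fun t ht => (integral_priorDensity_rpow hK hQ hn ht.1 ht.2).1)
  obtain ⟨-, hd₁⟩ := hasDerivAt_integral_rpow (ν := volume)
    (measurable_priorDensity (M := (0 : Matrix (Fin d) (Fin m) ℝ)) (K := 1) (n := n)
      Matrix.PosDef.one) (priorDensity_nonneg Matrix.PosDef.one Matrix.PosDef.one hn)
    (hev.mono fun t ht =>
      (integral_priorDensity_rpow Matrix.PosDef.one Matrix.PosDef.one hn ht.1 ht.2).1)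
  refine ⟨isProbDensity_priorDensity hK hQ hn, hi, ?_⟩
  set J := K.det ^ (-((d : ℝ) / 2)) * Q.det ^ (((m : ℝ) + d + 1) / 2) with hJ
  have hJ0 : 0 < J := by positivity
  have hpow : HasDerivAt (fun t : ℝ => J ^ (-t)) (-Real.log J) 0 := by
    simpa using (hasDerivAt_neg (0 : ℝ)).const_rpow hJ0
  -- The product rule for J^(-t) ∫ p₁^(1+t); since p₁ has mass one, the value at 0 is -log J + ∫ p₁
  -- log p₁.
  have hd₂ := (hpow.mul hd₁).congr_of_eventuallyEq (f₁ := fun t : ℝ => ∫ θ : Param d m,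
      priorDensity M K Q n θ ^ (1 + t)) (hev.mono fun t ht => by
    have := (integral_priorDensity_rpow (M := M) hK hQ hn ht.1 ht.2).2
    rw [sub_add_cancel_left] at this
    simpa using this)
  have hone := (isProbDensity_priorDensity (M := (0 : Matrix (Fin d) (Fin m) ℝ)) (n := n)
    Matrix.PosDef.one Matrix.PosDef.one hn).integral_eq_one
  rw [hd.unique hd₂]
  simp only [add_zero, Real.rpow_one, hone, neg_zero, Real.rpow_zero]
  rw [hJ, Real.log_mul (by positivity) (by positivity), Real.log_rpow hK0, Real.log_rpow hQ0,
    standardEntropy]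
  ring

end entropy

/-! ### Conjugacy and the posterior -/

section posterior

variable {d m : ℕ} {M : Matrix (Fin d) (Fin m) ℝ} {K : Matrix (Fin m) (Fin m) ℝ}
  {Q : Matrix (Fin d) (Fin d) ℝ} {n : ℝ}

/-- The mean of the posterior matrix normal distribution. -/
def posteriorMean (M : Matrix (Fin d) (Fin m) ℝ) (K : Matrix (Fin m) (Fin m) ℝ)
    (x : Fin m → ℝ) (y : Fin d → ℝ) : Matrix (Fin d) (Fin m) ℝ :=
  M + Matrix.vecMulVec (y - M *ᵥ x) ((Matrix.vecMulVec x x + K)⁻¹ *ᵥ x)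

/-- The scale matrix of the posterior inverse Wishart distribution. -/
def posteriorScale (M : Matrix (Fin d) (Fin m) ℝ) (K : Matrix (Fin m) (Fin m) ℝ)
    (Q : Matrix (Fin d) (Fin d) ℝ) (x : Fin m → ℝ) (y : Fin d → ℝ) :
    Matrix (Fin d) (Fin d) ℝ :=
  Q + gammaScalar K x • Matrix.vecMulVec (y - M *ᵥ x) (y - M *ᵥ x)

lemma posSemidef_vecMulVec_self {ι : Type*} [Fintype ι] (x : ι → ℝ) :
    (Matrix.vecMulVec x x).PosSemidef := by
  simpa using Matrix.posSemidef_vecMulVec_self_star x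

lemma posDef_vecMulVec_add (hK : K.PosDef) (x : Fin m → ℝ) :
    (Matrix.vecMulVec x x + K).PosDef :=
  Matrix.PosDef.posSemidef_add (posSemidef_vecMulVec_self x) hK

/-- With k = (xxᵀ + K)⁻¹x, pairing (xxᵀ + K)k = x with k gives x·k = (x·k)² + kᵀKk ≥ (x·k)², so x·k
≤ 1. -/
lemma gammaScalar_nonneg (hK : K.PosDef) (x : Fin m → ℝ) : 0 ≤ gammaScalar K x := by
  have hK' := posDef_vecMulVec_add hK x
  set k := (Matrix.vecMulVec x x + K)⁻¹ *ᵥ x with hk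
  have hKk : (Matrix.vecMulVec x x + K) *ᵥ k = x := by
    rw [hk, Matrix.mulVec_mulVec, Matrix.mul_nonsing_inv _ (isUnit_det_of_posDef hK'),
      Matrix.one_mulVec]
  have h1 : 0 ≤ k ⬝ᵥ (K *ᵥ k) := by simpa using hK.posSemidef.dotProduct_mulVec_nonneg k
  have h2 : x ⬝ᵥ k = (x ⬝ᵥ k) ^ 2 + k ⬝ᵥ (K *ᵥ k) := by
    conv_lhs => rw [dotProduct_comm, ← hKk]
    rw [Matrix.add_mulVec, dotProduct_add, Matrix.vecMulVec_mulVec, dotProduct_smul,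
      dotProduct_comm k x]
    simp [sq]
  rw [gammaScalar, ← hk]
  nlinarith

lemma posDef_posteriorScale (hK : K.PosDef) (hQ : Q.PosDef) (x : Fin m → ℝ) (y : Fin d → ℝ) :
    (posteriorScale M K Q x y).PosDef :=
  hQ.add_posSemidef ((posSemidef_vecMulVec_self _).smul (gammaScalar_nonneg hK x))

/-- Completing the square. -/
lemma scatter_add_vecMulVec (hK : K.PosDef) (x : Fin m → ℝ) (y : Fin d → ℝ)
    (A : Matrix (Fin d) (Fin m) ℝ) :
    scatter M K Q A + Matrix.vecMulVec (y - A *ᵥ x) (y - A *ᵥ x)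
      = scatter (posteriorMean M K x y) (Matrix.vecMulVec x x + K) (posteriorScale M K Q x y)
        A := by
  have hK' := posDef_vecMulVec_add hK x
  unfold scatter posteriorMean posteriorScale gammaScalar
  set L := Matrix.vecMulVec x x + K with hL
  set k := L⁻¹ *ᵥ x with hk
  set e := y - M *ᵥ x with he
  set X := A - M with hX
  have hLT : Lᵀ = L := by
    rw [← Matrix.conjTranspose_eq_transpose_of_trivial, hK'.isHermitian.eq]
  have hLk : L *ᵥ k = x := by
    rw [hk, Matrix.mulVec_mulVec, Matrix.mul_nonsing_inv _ (isUnit_det_of_posDef hK'),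
      Matrix.one_mulVec]
  have hkL : k ᵥ* L = x := by rw [← Matrix.mulVec_transpose, hLT, hLk]
  have hy : y - A *ᵥ x = e - X *ᵥ x := by
    rw [he, hX, Matrix.sub_mulVec]
    abel
  have hA : A - (M + Matrix.vecMulVec e k) = X - Matrix.vecMulVec e k := by
    rw [hX]
    abel
  clear_value X e
  -- With `K` eliminated, the products of `L` with `k` reduce to `x`, and both sides expand into
  -- matching terms.
  have hKL : K = L - Matrix.vecMulVec x x := by rw [hL]; abel
  have hXx : X * Matrix.vecMulVec x x * Xᵀ = Matrix.vecMulVec (X *ᵥ x) (X *ᵥ x) := by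
    rw [Matrix.mul_vecMulVec, Matrix.vecMulVec_mul, Matrix.vecMul_transpose]
  have h1 : Matrix.vecMulVec e k * L = Matrix.vecMulVec e x := by
    rw [Matrix.vecMulVec_mul, hkL]
  have h2 : X * L * Matrix.vecMulVec k e = Matrix.vecMulVec (X *ᵥ x) e := by
    rw [Matrix.mul_vecMulVec, ← Matrix.mulVec_mulVec, hLk]
  have h3 : Matrix.vecMulVec e x * Matrix.vecMulVec k e
      = (x ⬝ᵥ k) • Matrix.vecMulVec e e := by
    rw [Matrix.vecMulVec_mul_vecMulVec, Matrix.vecMulVec_smul]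
  rw [hy, hA, hKL, Matrix.mul_sub, Matrix.sub_mul, hXx, Matrix.transpose_sub,
    Matrix.transpose_vecMulVec, Matrix.sub_mul X, h1, Matrix.mul_sub, Matrix.sub_mul,
    Matrix.sub_mul, h2, h3, Matrix.vecMulVec_mul, Matrix.vecMul_transpose, sub_smul, one_smul]
  simp only [Matrix.sub_vecMulVec, Matrix.vecMulVec_sub]
  abel

/-- The likelihood contributes |V|^(-1/2), which raises `n` by one, and a rank-one term absorbed by
completing the square. -/
lemma likelihood_mul_priorDensity (hK : K.PosDef) (hQ : Q.PosDef) (hn : (d : ℝ) - 1 < n)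
    (x : Fin m → ℝ) (y : Fin d → ℝ) (θ : Param d m) :
    likelihood x y θ * priorDensity M K Q n θ
      = (2 * Real.pi) ^ ((d : ℝ) * -(1 / 2)) * priorConst K Q n /
          priorConst (Matrix.vecMulVec x x + K) (posteriorScale M K Q x y) (n + 1) *
        priorDensity (posteriorMean M K x y) (Matrix.vecMulVec x x + K)
          (posteriorScale M K Q x y) (n + 1) θ := by
  have hQ' := posDef_posteriorScale (M := M) hK hQ x y
  by_cases hV : θ.V.PosDef
  · have hV0 := hV.det_pos
    have hc' := priorConst_pos (posDef_vecMulVec_add hK x) hQ' (by linarith : (d : ℝ) - 1 < n + 1)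
    rw [priorDensity_of_posDef hQ hV, priorDensity_of_posDef hQ' hV, likelihood, gaussianDensity,
      det_smul_rpow hV (by positivity), ← scatter_add_vecMulVec hK, Matrix.mul_add,
      Matrix.trace_add, mul_add, Real.exp_add, Matrix.mul_vecMulVec, Matrix.trace_vecMulVec,
      dotProduct_comm (y - _) (_ *ᵥ _), ← mul_assoc (_ / _), div_mul_cancel₀ _ hc'.ne']
    have e : θ.V.det ^ (-((n + 1 + d + 1 + m) / 2))
        = θ.V.det ^ (-(1 / 2) : ℝ) * θ.V.det ^ (-((n + d + 1 + m) / 2)) := by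
      rw [← Real.rpow_add hV0]
      congr 1
      ring
    rw [e]
    ring
  · rw [priorDensity_of_not_posDef hV, priorDensity_of_not_posDef hV, mul_zero, mul_zero]

/-- The prior is conjugate. -/
theorem posteriorDensity_eq (hK : K.PosDef) (hQ : Q.PosDef) (hn : (d : ℝ) - 1 < n)
    (x : Fin m → ℝ) (y : Fin d → ℝ) :
    posteriorDensity M K Q n x y = priorDensity (posteriorMean M K x y)
      (Matrix.vecMulVec x x + K) (posteriorScale M K Q x y) (n + 1) := by
  have hQ' := posDef_posteriorScale (M := M) hK hQ x y
  have hn' : (d : ℝ) - 1 < n + 1 := by linarith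
  have hK' := posDef_vecMulVec_add hK x
  have hc := priorConst_pos hK hQ hn
  have hc' := priorConst_pos hK' hQ' hn'
  ext θ
  unfold posteriorDensity
  simp_rw [likelihood_mul_priorDensity hK hQ hn x y]
  -- The updated prior has mass one, so the evidence is exactly the proportionality constant and
  -- cancels.
  rw [integral_const_mul, (isProbDensity_priorDensity hK' hQ' hn').integral_eq_one, mul_one,
    mul_div_cancel_left₀]
  positivity

end posterior

end BayesRNN

end

/-- The dimension `m` is fixed; `f₁` depends on `d` and the degrees of freedom only. The first part
identifies `f₁` as the constant in the entropy of the prior family, the second one is the formula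
for the posterior, whose degrees of freedom are `n + 1`. -/
theorem mainTheorem5 (m : ℕ) :
    ∃ f₁ : ℕ → ℝ → ℝ,
      (∀ (d : ℕ) (n : ℝ), (d : ℝ) - 1 < n →
        ∀ (M : Matrix (Fin d) (Fin m) ℝ) (K : Matrix (Fin m) (Fin m) ℝ)
          (Q : Matrix (Fin d) (Fin d) ℝ), K.PosDef → Q.PosDef →
          BayesRNN.HasEntropy (volume : Measure (BayesRNN.Param d m))
            (BayesRNN.priorDensity M K Q n)
            (-((d : ℝ) / 2) * Real.log K.det
              + (((m : ℝ) + d + 1) / 2) * Real.log Q.det + f₁ d n)) ∧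
      (∀ (d : ℕ) (n : ℝ), (d : ℝ) - 1 < n →
        ∀ (M : Matrix (Fin d) (Fin m) ℝ) (K : Matrix (Fin m) (Fin m) ℝ)
          (Q : Matrix (Fin d) (Fin d) ℝ), K.PosDef → Q.PosDef →
        ∀ (x : Fin m → ℝ) (y : Fin d → ℝ),
          BayesRNN.HasEntropy (volume : Measure (BayesRNN.Param d m))
            (BayesRNN.posteriorDensity M K Q n x y)
            (-((d : ℝ) / 2) * Real.log (Matrix.vecMulVec x x + K).det
              + f₁ d (n + 1)
              + (((m : ℝ) + d + 1) / 2) *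
                Real.log (Q + BayesRNN.gammaScalar K x •
                  Matrix.vecMulVec (y - M *ᵥ x) (y - M *ᵥ x)).det)) := by
  refine ⟨fun d n => BayesRNN.standardEntropy d m n, fun d n hn M K Q hK hQ => ?_,
    fun d n hn M K Q hK hQ x y => ?_⟩
  · exact BayesRNN.hasEntropy_priorDensity hK hQ hn
  · rw [BayesRNN.posteriorDensity_eq hK hQ hn, add_right_comm]
    exact BayesRNN.hasEntropy_priorDensity (BayesRNN.posDef_vecMulVec_add hK x)
      (BayesRNN.posDef_posteriorScale hK hQ x y) (by linarith)
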